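/- Let $P$ be a probability law of a pair $(X,Y)\in\mathbb R^d\times\mathbb R$ with finite second moments and invertible Gram matrix $\Sigma=\mathbb E[XX^\top]$. Let $\beta=\arg\min_{\theta\in\mathbb R^d}\mathbb E[(Y-\theta^\top X)^2]$ be the projection parameter and $V=\mathrm{Var}[X(Y-X^\top\beta)]$. Let $(X_1,Y_1),\dots,(X_n,Y_n)$ be i.i.d. with law $P$, and let $\hat\beta$ be a least squares estimator, i.e. a minimizer of $\theta\mapsto n^{-1}\sum_{i=1}^n(Y_i-\theta^\top X_i)^2$. For $m,k>0$ write $q_{m,k}=(m/q_x+k/q)^{-1}$ and let $a_+=\max\{a,0\}$. Let $q_x\ge 4$ and $q\ge 2$ satisfy $(1/q_x+1/q)^{-1}>2$, and let $K_x\ge1$, $K_y>0$, $\underline\lambda>0$. There is a constant $C=C(q_x,q,K_x,K_y,\underline\lambda)>0$ such that the following holds for all $n$, $d$, all $\overline\lambda\in[\underline\lambda,\infty)$ and all $P$ as above with $$\left(\mathbb E|Y-X^\top\beta|^q\right)^{1/q}\le K_y,\qquad \left(\mathbb E|u^\top\Sigma^{-1/2}X|^{q_x}\right)^{1/q_x}\le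 K_x\ \text{ for all } u\in\mathbb R^d \text{ with } \|u\|_2=1,$$ $$\underline\lambda\le\lambda_{\min}(\Sigma^{-1/2}V\Sigma^{-1/2})\le\lambda_{\max}(\Sigma^{-1/2}V\Sigma^{-1/2})\le\overline\lambda .$$ For all $\delta_0,\delta_1,\delta_2>0$, with probability at least $1-\delta_0-\delta_1-\delta_2$, $$\max_{1\le i\le n}|X_i^\top(\hat\beta-\beta)|\le C\left(1-9K_x^2\sqrt{\frac{d+2\log(2n/\delta_0)}{n}}\right)_+^{-1}\left\{\sqrt{\frac{d+\log(2n/\delta_1)}{\delta_1^{2/q_x}n^{1-2/q_x}}}+\frac{\sqrt d}{\delta_1^{1/q_{2,1}}n^{1-1/q_{3,2}}}+\frac{d}{\delta_2^{1/q_{2,1}}n^{1-1/q_{2,1}}}\right\},$$ where the right-hand side is read as $+\infty$ (no claim is made) when the positive part is $0$. -/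

import Mathlib

open MeasureTheory ProbabilityTheory
open scoped Matrix MatrixOrder

noncomputable section

namespace LinReg

variable {d n : ℕ}

/-- The population Gram matrix `Σ = E[X Xᵀ]` of the law `P` of a pair `(X, Y)`. -/
def gram (P : Measure ((Fin d → ℝ) × ℝ)) : Matrix (Fin d) (Fin d) ℝ :=
  Matrix.of fun a b => ∫ z, z.1 a * z.1 b ∂P

/-- `Σ^{-1/2}`: the inverse of the positive semidefinite square root of the Gram matrix. -/
def invSqrtGram (P : Measure ((Fin d → ℝ) × ℝ)) : Matrix (Fin d) (Fin d) ℝ :=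
  (CFC.sqrt (gram P))⁻¹

/-- `β` is the projection parameter: it minimizes `θ ↦ E[(Y - θᵀX)²]`. -/
def IsProjectionParameter (P : Measure ((Fin d → ℝ) × ℝ)) (β : Fin d → ℝ) : Prop :=
  ∀ θ : Fin d → ℝ, ∫ z, (z.2 - β ⬝ᵥ z.1) ^ 2 ∂P ≤ ∫ z, (z.2 - θ ⬝ᵥ z.1) ^ 2 ∂P

/-- `b` is a least squares estimate for the data `(x i, y i)`: it minimizes
`θ ↦ (1/n) ∑ᵢ (yᵢ - θᵀxᵢ)²`. -/
def IsLeastSquares (x : Fin n → Fin d → ℝ) (y : Fin n → ℝ) (b : Fin d → ℝ) : Prop :=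
  ∀ θ : Fin d → ℝ,
    (1 / (n : ℝ)) * ∑ i, (y i - b ⬝ᵥ x i) ^ 2 ≤ (1 / (n : ℝ)) * ∑ i, (y i - θ ⬝ᵥ x i) ^ 2

/-- `V = Var[X (Y - Xᵀβ)]`, a `d × d` covariance matrix. -/
def scoreCov (P : Measure ((Fin d → ℝ) × ℝ)) (β : Fin d → ℝ) : Matrix (Fin d) (Fin d) ℝ :=
  Matrix.of fun a b =>
    cov[fun z => z.1 a * (z.2 - z.1 ⬝ᵥ β), fun z => z.1 b * (z.2 - z.1 ⬝ᵥ β); P]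

/-- The standing setting: `P` is a probability law on `ℝᵈ × ℝ` with finite second moments and
invertible Gram matrix. -/
structure IsRegressionLaw (P : Measure ((Fin d → ℝ) × ℝ)) : Prop where
  isProbabilityMeasure : IsProbabilityMeasure P
  memLp_covariate : ∀ a, MemLp (fun z : (Fin d → ℝ) × ℝ => z.1 a) 2 P
  memLp_response : MemLp (fun z : (Fin d → ℝ) × ℝ => z.2) 2 P
  isUnit_gram : IsUnit (gram P)

/-- Error moments: `(E|Y - Xᵀβ|^q)^{1/q} ≤ K_y`. -/
def ErrorMoment (P : Measure ((Fin d → ℝ) × ℝ)) (β : Fin d → ℝ) (q Ky : ℝ) : Prop :=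
  eLpNorm (fun z => z.2 - z.1 ⬝ᵥ β) (ENNReal.ofReal q) P ≤ ENNReal.ofReal Ky

/-- Covariate moments: `(E|uᵀ Σ^{-1/2} X|^{q_x})^{1/q_x} ≤ K_x` for every `u` in the Euclidean
unit sphere. -/
def CovariateMoment (P : Measure ((Fin d → ℝ) × ℝ)) (qx Kx : ℝ) : Prop :=
  ∀ u : Fin d → ℝ, u ⬝ᵥ u = 1 →
    eLpNorm (fun z => u ⬝ᵥ (invSqrtGram P *ᵥ z.1)) (ENNReal.ofReal qx) P ≤ ENNReal.ofReal Kx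

/-- All eigenvalues of the symmetric matrix `Σ^{-1/2} V Σ^{-1/2}` lie in `[lo, hi]`. -/
def ScoreEigenvalueBounds (P : Measure ((Fin d → ℝ) × ℝ)) (β : Fin d → ℝ) (lo hi : ℝ) : Prop :=
  spectrum ℝ (invSqrtGram P * scoreCov P β * invSqrtGram P) ⊆ Set.Icc lo hi

/-- `q_{m,k} = (m / q_x + k / q)⁻¹`. -/
def harm (qx q m k : ℝ) : ℝ := (m / qx + k / q)⁻¹

/-- `1 - 9 K_x² √((d + 2 log (2n/δ₀)) / n)`. -/
def gramFactor (n d : ℕ) (Kx δ₀ : ℝ) : ℝ :=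
  1 - 9 * Kx ^ 2 * Real.sqrt ((d + 2 * Real.log (2 * n / δ₀)) / n)

/-- The sum of the three error terms in the bound. -/
def rate (n d : ℕ) (qx q δ₁ δ₂ : ℝ) : ℝ :=
  Real.sqrt ((d + Real.log (2 * n / δ₁)) / (δ₁ ^ (2 / qx) * (n : ℝ) ^ (1 - 2 / qx)))
    + Real.sqrt d / (δ₁ ^ (1 / harm qx q 2 1) * (n : ℝ) ^ (1 - 1 / harm qx q 3 2))
    + d / (δ₂ ^ (1 / harm qx q 2 1) * (n : ℝ) ^ (1 - 1 / harm qx q 2 1))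

end LinReg

end

/-!
Whiten the covariates to `W = Σ^{-1/2} X`, let `e = Y - Xᵀβ` be the residuals and put
`θ = Σ^{1/2} (β̂ - β)`, so that `Xᵢᵀ(β̂ - β) = ⟪Wᵢ, θ⟫` and `∑ⱼ (eⱼ - ⟪Wⱼ, θ⟫) Wⱼ = 0`. Let
`A₋ᵢ` and `S₋ᵢ` be the sums of `Wⱼ Wⱼᵀ` and of the scores `eⱼ Wⱼ` over `j ≠ i`. If every `A₋ᵢ` is
at least `c > 0`, removing observation `i` from the normal equations gives
`|⟪Wᵢ, θ⟫| ≤ |⟪A₋ᵢ⁻¹ S₋ᵢ, Wᵢ⟫| + c⁻¹ ‖Wᵢ‖² |eᵢ|`.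

With `c = (n - 1) / 5` the Gram operators are bounded below by a lower tail inequality that only
needs fourth moments: truncated squares `⟪v, W⟫²` satisfy a Chernoff bound, whose exponents are
summable over the lattice `(1 / (2 √d)) ℤᵈ`; since the Gram form is quadratic, rounding a unit
vector coordinatewise at random to this lattice changes it on average by at most a multiple of its
trace, which the Chernoff exponent compensates. In the first term `Wᵢ` is independent of
`A₋ᵢ⁻¹ S₋ᵢ`, so Markov's inequality of order `q_x` applies conditionally on the other observations;
the moment of `‖S₋ᵢ‖` comes from truncating the scores and a Rosenthal inequality. The leverage
term `‖Wᵢ‖² |eᵢ|` has a moment of order `q_{2,1}`, and a union bound over `i` finishes the proof.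
-/

namespace LinReg

section PowerInequalities

variable {a b r : ℝ}

theorem rpow_le_rpow_add_mul_sub (ha : 0 ≤ a) (hb : 0 ≤ b) (hr : 1 ≤ r) :
    b ^ r ≤ a ^ r + r * (b - a) * b ^ (r - 1) := by
  have hr0 : 0 < r := by linarith
  have hbr : b ^ r = b * b ^ (r - 1) := by
    rw [← Real.rpow_one_add' hb (by linarith), add_sub_cancel]
  have young : a * b ^ (r - 1) ≤ r⁻¹ * a ^ r + (1 - r⁻¹) * b ^ r := by
    have h := Real.geom_mean_le_arith_mean2_weighted (inv_nonneg.2 hr0.le)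
      (sub_nonneg.2 (inv_le_one_of_one_le₀ hr)) (Real.rpow_nonneg ha r) (Real.rpow_nonneg hb r)
      (add_sub_cancel _ _)
    rwa [Real.rpow_rpow_inv ha hr0.ne', ← Real.rpow_mul hb, mul_sub, mul_one,
      mul_inv_cancel₀ hr0.ne'] at h
  have h := mul_le_mul_of_nonneg_left young hr0.le
  rw [mul_add, mul_inv_cancel_left₀ hr0.ne', ← mul_assoc r (1 - r⁻¹), mul_one_sub,
    mul_inv_cancel₀ hr0.ne'] at h
  linear_combination h + r * hbr

theorem abs_rpow_sub_rpow_le {c : ℝ} (ha : 0 ≤ a) (hb : 0 ≤ b) (hac : a ≤ c) (hbc : b ≤ c)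
    (hr : 1 ≤ r) : |b ^ r - a ^ r| ≤ r * |b - a| * c ^ (r - 1) := by
  have upper : ∀ {x y : ℝ}, 0 ≤ x → 0 ≤ y → y ≤ c → y ^ r - x ^ r ≤ r * |y - x| * c ^ (r - 1) :=
    fun {x y} hx hy hyc => by
      have : r * (y - x) * y ^ (r - 1) ≤ r * |y - x| * c ^ (r - 1) := by
        gcongr
        exact le_abs_self _
      linarith [rpow_le_rpow_add_mul_sub hx hy hr]
  exact abs_sub_le_iff.2 ⟨upper ha hb hbc, abs_sub_comm b a ▸ upper hb ha hac⟩

theorem add_rpow_le (ha : 0 ≤ a) (hb : 0 ≤ b) (hr : 1 ≤ r) :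
    (a + b) ^ r ≤ 2 ^ (r - 1) * (a ^ r + b ^ r) :=
  mod_cast NNReal.rpow_add_le_mul_rpow_add_rpow ⟨a, ha⟩ ⟨b, hb⟩ hr

theorem rpow_mul_rpow_le_rpow_add_rpow {t : ℝ} (ha : 0 ≤ a) (hb : 0 ≤ b) (hr : 0 ≤ r)
    (ht : 0 ≤ t) : a ^ r * b ^ t ≤ a ^ (r + t) + b ^ (r + t) := by
  rcases le_total a b with h | h
  · calc a ^ r * b ^ t ≤ b ^ r * b ^ t := by gcongr
      _ = b ^ (r + t) := (Real.rpow_add_of_nonneg hb hr ht).symm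
      _ ≤ _ := le_add_of_nonneg_left (by positivity)
  · calc a ^ r * b ^ t ≤ a ^ r * a ^ t := by gcongr
      _ = a ^ (r + t) := (Real.rpow_add_of_nonneg ha hr ht).symm
      _ ≤ _ := le_add_of_nonneg_right (by positivity)

end PowerInequalities

section NormAdd

variable {F : Type*} [NormedAddCommGroup F] {p : ℝ}

theorem abs_norm_add_sq_sub_norm_sq_le (x z : F) :
    |‖x + z‖ ^ 2 - ‖x‖ ^ 2| ≤ 2 * ‖z‖ * (‖x‖ + ‖z‖) := by
  have hsub : |‖x + z‖ - ‖x‖| ≤ ‖z‖ := by simpa using abs_norm_sub_norm_le (x + z) x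
  have hadd : ‖x + z‖ + ‖x‖ ≤ 2 * (‖x‖ + ‖z‖) := by
    linarith [norm_add_le x z, norm_nonneg z]
  calc |‖x + z‖ ^ 2 - ‖x‖ ^ 2| = (‖x + z‖ + ‖x‖) * |‖x + z‖ - ‖x‖| := by
        rw [sq_sub_sq, abs_mul, abs_of_nonneg (by positivity)]
    _ ≤ 2 * (‖x‖ + ‖z‖) * ‖z‖ := by gcongr
    _ = _ := by ring

theorem norm_sq_rpow_div_two (x : F) (p : ℝ) : (‖x‖ ^ 2) ^ (p / 2) = ‖x‖ ^ p := by
  rw [← Real.rpow_natCast, ← Real.rpow_mul (norm_nonneg x)]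
  congr 1
  push_cast
  ring

theorem norm_add_rpow_cross_term_le (hp : 3 ≤ p) (x z : F) :
    (p / 2) * (‖x + z‖ ^ 2 - ‖x‖ ^ 2) * (‖x + z‖ ^ (p - 2) - ‖x‖ ^ (p - 2)) ≤
      p * (p - 2) * 2 ^ (p - 3) * (‖x‖ ^ (p - 2) * ‖z‖ ^ 2 + ‖z‖ ^ p) := by
  have hpow := abs_rpow_sub_rpow_le (norm_nonneg x) (norm_nonneg (x + z))
    (le_add_of_nonneg_right (norm_nonneg z)) (norm_add_le x z) (by linarith : 1 ≤ p - 2)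
  have hsub : |‖x + z‖ - ‖x‖| ≤ ‖z‖ := by simpa using abs_norm_sub_norm_le (x + z) x
  have hc : (‖x‖ + ‖z‖) * (‖x‖ + ‖z‖) ^ (p - 2 - 1) = (‖x‖ + ‖z‖) ^ (p - 2) := by
    rw [← Real.rpow_one_add' (by positivity) (by linarith), add_sub_cancel]
  have hz : ‖z‖ ^ 2 * ‖z‖ ^ (p - 2) = ‖z‖ ^ p := by
    rw [← Real.rpow_natCast, ← Real.rpow_add' (norm_nonneg z) (by norm_num; linarith)]
    norm_num
  calc (p / 2) * (‖x + z‖ ^ 2 - ‖x‖ ^ 2) * (‖x + z‖ ^ (p - 2) - ‖x‖ ^ (p - 2))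
      ≤ (p / 2) * (|‖x + z‖ ^ 2 - ‖x‖ ^ 2| * |‖x + z‖ ^ (p - 2) - ‖x‖ ^ (p - 2)|) := by
        rw [mul_assoc, ← abs_mul]
        gcongr
        exact le_abs_self _
    _ ≤ (p / 2) * (2 * ‖z‖ * (‖x‖ + ‖z‖) *
          ((p - 2) * ‖z‖ * (‖x‖ + ‖z‖) ^ (p - 2 - 1))) := by
        gcongr
        · exact abs_norm_add_sq_sub_norm_sq_le x z
        · refine hpow.trans ?_
          gcongr
          linarith
    _ = p * (p - 2) * ‖z‖ ^ 2 * (‖x‖ + ‖z‖) ^ (p - 2) := by rw [← hc]; ring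
    _ ≤ p * (p - 2) * ‖z‖ ^ 2 * (2 ^ (p - 2 - 1) * (‖x‖ ^ (p - 2) + ‖z‖ ^ (p - 2))) := by
        have : 0 ≤ p - 2 := by linarith
        gcongr
        exact add_rpow_le (norm_nonneg x) (norm_nonneg z) (by linarith)
    _ = p * (p - 2) * 2 ^ (p - 3) * (‖x‖ ^ (p - 2) * ‖z‖ ^ 2 + ‖z‖ ^ p) := by
        rw [← hz, show p - 2 - 1 = p - 3 by ring]
        ring

variable [InnerProductSpace ℝ F]

theorem norm_add_rpow_le (hp : 3 ≤ p) (x z : F) :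
    ‖x + z‖ ^ p ≤ ‖x‖ ^ p + p * ‖x‖ ^ (p - 2) * inner ℝ x z
      + p ^ 2 * 2 ^ p * (‖x‖ ^ (p - 2) * ‖z‖ ^ 2 + ‖z‖ ^ p) := by
  have tangent := rpow_le_rpow_add_mul_sub (sq_nonneg ‖x‖) (sq_nonneg ‖x + z‖)
    (by linarith : 1 ≤ p / 2)
  rw [show p / 2 - 1 = (p - 2) / 2 by ring, norm_sq_rpow_div_two, norm_sq_rpow_div_two,
    norm_sq_rpow_div_two] at tangent
  have hsq : ‖x + z‖ ^ 2 - ‖x‖ ^ 2 = 2 * inner ℝ x z + ‖z‖ ^ 2 := by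
    rw [norm_add_sq_real]
    ring
  have hconst : p / 2 + p * (p - 2) * 2 ^ (p - 3) ≤ p ^ 2 * 2 ^ p := by
    have h1 : (1 : ℝ) ≤ 2 ^ p := Real.one_le_rpow one_le_two (by linarith)
    have h2 : (2 : ℝ) ^ (p - 3) ≤ 2 ^ p := by gcongr <;> linarith
    have h3 : p * (p - 2) * 2 ^ (p - 3) ≤ p * (p - 2) * 2 ^ p := by
      have : 0 ≤ p - 2 := by linarith
      gcongr
    nlinarith
  have hrem : 0 ≤ ‖x‖ ^ (p - 2) * ‖z‖ ^ 2 + ‖z‖ ^ p := by positivity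
  have hz : 0 ≤ p / 2 * ‖z‖ ^ p := by positivity
  have hcross := norm_add_rpow_cross_term_le hp x z
  have hmain := mul_le_mul_of_nonneg_right hconst hrem
  rw [hsq] at tangent hcross
  linear_combination tangent + hcross + hmain + hz

end NormAdd

section Rosenthal

variable {E F : Type*} [MeasurableSpace E] [NormedAddCommGroup F] {P : Measure E} {g : E → F}
  {p D : ℝ}

theorem integrable_norm_rpow_of_memLp (hp : 0 < p) (hg : MemLp g (.ofReal p) P) :
    Integrable (fun x => ‖g x‖ ^ p) P := by
  simpa only [ENNReal.toReal_ofReal hp.le] using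
    hg.integrable_norm_rpow (by simpa) ENNReal.ofReal_ne_top

theorem integrable_norm_sq_of_memLp [IsFiniteMeasure P] (hp : 2 ≤ p) (hg : MemLp g (.ofReal p) P) :
    Integrable (fun x => ‖g x‖ ^ 2) P :=
  (hg.mono_exponent (by simpa using ENNReal.ofReal_le_ofReal hp)).integrable_norm_pow (by simp)

variable [IsProbabilityMeasure P]

theorem memLp_sum_apply {N : ℕ} {q : ENNReal} (hg : MemLp g q P) :
    MemLp (fun z : Fin N → E => ∑ j, g (z j)) q (Measure.pi fun _ => P) :=
  memLp_finsetSum _ fun j _ => hg.comp_measurePreserving (measurePreserving_eval _ j)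

theorem integral_norm_sum_succ_rpow {N : ℕ} (hp : 0 < p) (hg : MemLp g (.ofReal p) P) :
    ∫ z, ‖∑ j, g (z j)‖ ^ p ∂(Measure.pi fun _ : Fin (N + 1) => P) =
      ∫ z, ∫ e, ‖∑ j, g (z j) + g e‖ ^ p ∂P ∂(Measure.pi fun _ : Fin N => P) := by
  have hint : Integrable (fun x : E × (Fin N → E) => ‖∑ j, g (x.2 j) + g x.1‖ ^ p)
      (P.prod (Measure.pi fun _ => P)) :=
    integrable_norm_rpow_of_memLp hp
      (((memLp_sum_apply (N := N) hg).comp_snd P).add (hg.comp_fst (Measure.pi fun _ => P)))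
  rw [← integral_prod_symm _ hint,
    ← (measurePreserving_piFinSuccAbove (fun _ : Fin (N + 1) => P) 0).integral_comp
      (MeasurableEquiv.measurableEmbedding _)]
  simp only [Fin.sum_univ_succ]
  congr with z
  rw [add_comm]
  rfl

variable [InnerProductSpace ℝ F]

theorem integral_norm_add_rpow_le [CompleteSpace F] (hp : 3 ≤ p) (hg : MemLp g (.ofReal p) P)
    (x : F) : ∫ e, ‖x + g e‖ ^ p ∂P ≤ ‖x‖ ^ p + p * ‖x‖ ^ (p - 1) * ‖∫ e, g e ∂P‖
      + p ^ 2 * 2 ^ p * (‖x‖ ^ (p - 2) * ∫ e, ‖g e‖ ^ 2 ∂P + ∫ e, ‖g e‖ ^ p ∂P) := by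
  have hp0 : 0 < p := by linarith
  have hg1 : Integrable g P := hg.integrable (ENNReal.one_le_ofReal.2 (by linarith))
  have hg2 := integrable_norm_sq_of_memLp (by linarith) hg
  have hgp := integrable_norm_rpow_of_memLp hp0 hg
  have : Integrable (fun e => inner ℝ x (g e)) P := hg1.const_inner x
  have hcross : p * ‖x‖ ^ (p - 2) * inner ℝ x (∫ e, g e ∂P)
      ≤ p * ‖x‖ ^ (p - 1) * ‖∫ e, g e ∂P‖ := by
    calc p * ‖x‖ ^ (p - 2) * inner ℝ x (∫ e, g e ∂P)
        ≤ p * ‖x‖ ^ (p - 2) * (‖x‖ * ‖∫ e, g e ∂P‖) := by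
          gcongr
          exact real_inner_le_norm x _
      _ = _ := by
          rw [show p - 1 = p - 2 + 1 by ring, Real.rpow_add_one' (norm_nonneg x) (by linarith)]
          ring
  calc ∫ e, ‖x + g e‖ ^ p ∂P
      ≤ ∫ e, (‖x‖ ^ p + p * ‖x‖ ^ (p - 2) * inner ℝ x (g e)
          + p ^ 2 * 2 ^ p * (‖x‖ ^ (p - 2) * ‖g e‖ ^ 2 + ‖g e‖ ^ p)) ∂P :=
        integral_mono (integrable_norm_rpow_of_memLp hp0 ((memLp_const x).add hg)) (by fun_prop)
          fun e => norm_add_rpow_le hp x (g e)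
    _ = ‖x‖ ^ p + p * ‖x‖ ^ (p - 2) * inner ℝ x (∫ e, g e ∂P)
          + p ^ 2 * 2 ^ p * (‖x‖ ^ (p - 2) * ∫ e, ‖g e‖ ^ 2 ∂P + ∫ e, ‖g e‖ ^ p ∂P) := by
        rw [integral_add (by fun_prop) (by fun_prop), integral_add (by fun_prop) (by fun_prop),
          integral_const_mul, integral_const_mul, integral_add (by fun_prop) hgp,
          integral_const_mul, integral_inner hg1]
        simp
    _ ≤ _ := by gcongr

/-- The constant in the Rosenthal-type inequality `integral_norm_sum_rpow_le`. -/
noncomputable def rosenthalConst (p : ℝ) : ℝ := 6 * p ^ 2 * 2 ^ p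

theorem one_le_rosenthalConst (hp : 1 ≤ p) : 1 ≤ rosenthalConst p := by
  have h1 : (1 : ℝ) ≤ 2 ^ p := Real.one_le_rpow one_le_two (by linarith)
  have h2 : 1 ≤ p ^ 2 := one_le_pow₀ hp
  unfold rosenthalConst
  nlinarith

theorem integral_norm_add_rpow_le_of_moments_le [CompleteSpace F] {n : ℝ} (hn : 0 < n) (hp : 3 ≤ p)
    (hD : 0 ≤ D) (hg : MemLp g (.ofReal p) P)
    (hmean : rosenthalConst p * n * ‖∫ e, g e ∂P‖ ≤ D)
    (hsq : rosenthalConst p * n * ∫ e, ‖g e‖ ^ 2 ∂P ≤ D ^ 2)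
    (hpow : rosenthalConst p * n * ∫ e, ‖g e‖ ^ p ∂P ≤ D ^ p) (x : F) :
    ∫ e, ‖x + g e‖ ^ p ∂P ≤ ‖x‖ ^ p + (‖x‖ ^ p + D ^ p) / (2 * n) := by
  set κ := p ^ 2 * 2 ^ p with hκ
  have hK : rosenthalConst p = 6 * κ := mul_assoc _ _ _
  have hpκ : p ≤ κ := by
    have : (1 : ℝ) ≤ 2 ^ p := Real.one_le_rpow one_le_two (by linarith)
    nlinarith
  have h1 := rpow_mul_rpow_le_rpow_add_rpow (norm_nonneg x) hD (by linarith : 0 ≤ p - 1) zero_le_one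
  have h2 := rpow_mul_rpow_le_rpow_add_rpow (norm_nonneg x) hD (by linarith : 0 ≤ p - 2) zero_le_two
  rw [sub_add_cancel, Real.rpow_one] at h1
  rw [sub_add_cancel, Real.rpow_two] at h2
  set X := ‖x‖ ^ p + D ^ p with hX
  have hx : 0 ≤ ‖x‖ ^ p := by positivity
  have mean_term : 6 * n * (p * ‖x‖ ^ (p - 1) * ‖∫ e, g e ∂P‖) ≤ X := by
    calc 6 * n * (p * ‖x‖ ^ (p - 1) * ‖∫ e, g e ∂P‖)
        ≤ 6 * n * (κ * ‖x‖ ^ (p - 1) * ‖∫ e, g e ∂P‖) := by gcongr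
      _ = ‖x‖ ^ (p - 1) * (rosenthalConst p * n * ‖∫ e, g e ∂P‖) := by rw [hK]; ring
      _ ≤ ‖x‖ ^ (p - 1) * D := by gcongr
      _ ≤ X := h1
  have sq_term : 6 * n * (κ * (‖x‖ ^ (p - 2) * ∫ e, ‖g e‖ ^ 2 ∂P)) ≤ X := by
    calc 6 * n * (κ * (‖x‖ ^ (p - 2) * ∫ e, ‖g e‖ ^ 2 ∂P))
        = ‖x‖ ^ (p - 2) * (rosenthalConst p * n * ∫ e, ‖g e‖ ^ 2 ∂P) := by rw [hK]; ring
      _ ≤ ‖x‖ ^ (p - 2) * D ^ 2 := by gcongr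
      _ ≤ X := h2
  have pow_term : 6 * n * (κ * ∫ e, ‖g e‖ ^ p ∂P) ≤ X := by
    rw [hK] at hpow
    linarith
  refine (integral_norm_add_rpow_le hp hg x).trans ?_
  suffices p * ‖x‖ ^ (p - 1) * ‖∫ e, g e ∂P‖
      + κ * (‖x‖ ^ (p - 2) * ∫ e, ‖g e‖ ^ 2 ∂P + ∫ e, ‖g e‖ ^ p ∂P) ≤ X / (2 * n) by linarith
  rw [le_div_iff₀ (by positivity)]
  linarith

theorem integral_norm_sum_rpow_le [CompleteSpace F] {n : ℝ} (hn : 0 < n) (hp : 3 ≤ p)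
    (hD : 0 ≤ D) (hg : MemLp g (.ofReal p) P)
    (hmean : rosenthalConst p * n * ‖∫ e, g e ∂P‖ ≤ D)
    (hsq : rosenthalConst p * n * ∫ e, ‖g e‖ ^ 2 ∂P ≤ D ^ 2)
    (hpow : rosenthalConst p * n * ∫ e, ‖g e‖ ^ p ∂P ≤ D ^ p) {N : ℕ} (hN : N ≤ n) :
    ∫ z, ‖∑ j, g (z j)‖ ^ p ∂(Measure.pi fun _ : Fin N => P) ≤ N / n * D ^ p := by
  have hp0 : 0 < p := by linarith
  induction N with
  | zero => simp [Real.zero_rpow hp0.ne']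
  | succ N ih =>
    push_cast at hN ⊢
    specialize ih (by linarith)
    have hint := integrable_norm_rpow_of_memLp hp0 (memLp_sum_apply (N := N) hg)
    have hNn : N / n * D ^ p ≤ D ^ p :=
      mul_le_of_le_one_left (by positivity) ((div_le_one hn).2 (by linarith))
    calc ∫ z, ‖∑ j, g (z j)‖ ^ p ∂(Measure.pi fun _ : Fin (N + 1) => P)
        = ∫ z, ∫ e, ‖∑ j, g (z j) + g e‖ ^ p ∂P ∂(Measure.pi fun _ : Fin N => P) :=
          integral_norm_sum_succ_rpow hp0 hg
      _ ≤ ∫ z, (‖∑ j, g (z j)‖ ^ p + (‖∑ j, g (z j)‖ ^ p + D ^ p) / (2 * n))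
            ∂(Measure.pi fun _ : Fin N => P) :=
          integral_mono_of_nonneg (ae_of_all _ fun _ => integral_nonneg fun _ => by positivity)
            (by fun_prop) (ae_of_all _ fun z =>
              integral_norm_add_rpow_le_of_moments_le hn hp hD hg hmean hsq hpow _)
      _ = ∫ z, ‖∑ j, g (z j)‖ ^ p ∂(Measure.pi fun _ : Fin N => P)
            + (∫ z, ‖∑ j, g (z j)‖ ^ p ∂(Measure.pi fun _ : Fin N => P) + D ^ p) / (2 * n) := by
          rw [integral_add hint (by fun_prop), integral_div, integral_add hint (by fun_prop)]
          simp
      _ ≤ N / n * D ^ p + (D ^ p + D ^ p) / (2 * n) := by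
          gcongr
          exact ih.trans hNn
      _ = (N + 1) / n * D ^ p := by field_simp; ring

end Rosenthal

/-- The truncation of a vector at norm `M`: longer vectors are replaced by zero. -/
noncomputable def truncNorm {F : Type*} [NormedAddCommGroup F] (M : ℝ) (z : F) : F :=
  if ‖z‖ ≤ M then z else 0

section Truncation

variable {E F : Type*} [MeasurableSpace E] [NormedAddCommGroup F] {P : Measure E} {Z : E → F}
  {M p s A n ℓ : ℝ}

theorem norm_truncNorm_le (hM : 0 ≤ M) (z : F) : ‖truncNorm M z‖ ≤ M := by
  unfold truncNorm
  split_ifs with h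
  exacts [h, norm_zero.trans_le hM]

theorem norm_truncNorm_le_norm (M : ℝ) (z : F) : ‖truncNorm M z‖ ≤ ‖z‖ := by
  unfold truncNorm
  split_ifs with h
  exacts [le_rfl, norm_zero.trans_le (norm_nonneg z)]

theorem norm_sub_truncNorm_le (hM : 0 < M) (hs : 1 ≤ s) (z : F) :
    ‖z - truncNorm M z‖ ≤ M ^ (1 - s) * ‖z‖ ^ s := by
  unfold truncNorm
  split_ifs with h
  · rw [sub_self, norm_zero]
    positivity
  · rw [not_le] at h
    have hz : 0 < ‖z‖ := hM.trans h
    calc ‖z - 0‖ = ‖z‖ ^ (1 - s) * ‖z‖ ^ s := by rw [← Real.rpow_add hz]; simp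
      _ ≤ M ^ (1 - s) * ‖z‖ ^ s := by
        gcongr ?_ * _
        exact Real.rpow_le_rpow_of_nonpos hM h.le (by linarith)

theorem norm_truncNorm_rpow_le (hM : 0 ≤ M) (hs : 0 < s) (hsp : s ≤ p) (z : F) :
    ‖truncNorm M z‖ ^ p ≤ M ^ (p - s) * ‖z‖ ^ s := by
  calc ‖truncNorm M z‖ ^ p = ‖truncNorm M z‖ ^ (p - s) * ‖truncNorm M z‖ ^ s := by
        rw [← Real.rpow_add_of_nonneg (norm_nonneg _) (by linarith) hs.le, sub_add_cancel]
    _ ≤ M ^ (p - s) * ‖z‖ ^ s := by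
        gcongr
        exacts [norm_truncNorm_le hM z, norm_truncNorm_le_norm M z]

theorem integral_norm_rpow_le_of_eLpNorm_le (hp : 0 < p) (hA : 0 ≤ A)
    (hZ : AEStronglyMeasurable Z P) (h : eLpNorm Z (.ofReal p) P ≤ .ofReal A) :
    ∫ x, ‖Z x‖ ^ p ∂P ≤ A ^ p := by
  have hmem : MemLp Z (.ofReal p) P := ⟨hZ, h.trans_lt ENNReal.ofReal_lt_top⟩
  rw [hmem.eLpNorm_eq_integral_rpow_norm (by simpa) ENNReal.ofReal_ne_top,
    ENNReal.toReal_ofReal hp.le, ENNReal.ofReal_le_ofReal_iff hA,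
    Real.rpow_inv_le_iff_of_pos (integral_nonneg fun _ => by positivity) hA hp] at h
  exact h

theorem measurable_truncNorm [MeasurableSpace F] [OpensMeasurableSpace F] (M : ℝ) :
    Measurable (truncNorm M : F → F) :=
  Measurable.ite (measurableSet_le measurable_norm measurable_const) measurable_id measurable_const

theorem aestronglyMeasurable_truncNorm (M : ℝ) (hZ : AEStronglyMeasurable Z P) :
    AEStronglyMeasurable (fun x => truncNorm M (Z x)) P :=
  hZ.indicator₀ (nullMeasurableSet_le hZ.norm.aemeasurable aemeasurable_const)

theorem memLp_truncNorm [IsFiniteMeasure P] (hM : 0 ≤ M) (hZ : AEStronglyMeasurable Z P)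
    (q : ENNReal) : MemLp (fun x => truncNorm M (Z x)) q P :=
  .of_bound (aestronglyMeasurable_truncNorm M hZ) M
    (ae_of_all _ fun x => norm_truncNorm_le hM (Z x))

theorem norm_integral_truncNorm_le [NormedSpace ℝ F] [IsFiniteMeasure P] (hM : 0 < M) (hs : 1 ≤ s)
    (hZ : MemLp Z (.ofReal s) P) (hmean : ∫ x, Z x ∂P = 0) :
    ‖∫ x, truncNorm M (Z x) ∂P‖ ≤ M ^ (1 - s) * ∫ x, ‖Z x‖ ^ s ∂P := by
  have hZi : Integrable Z P := hZ.integrable (ENNReal.one_le_ofReal.2 hs)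
  have hTi : Integrable (fun x => truncNorm M (Z x)) P :=
    (memLp_truncNorm hM.le hZ.1 1).integrable le_rfl
  calc ‖∫ x, truncNorm M (Z x) ∂P‖ = ‖∫ x, (Z x - truncNorm M (Z x)) ∂P‖ := by
        rw [integral_sub hZi hTi, hmean, zero_sub, norm_neg]
    _ ≤ ∫ x, ‖Z x - truncNorm M (Z x)‖ ∂P := norm_integral_le_integral_norm _
    _ ≤ ∫ x, M ^ (1 - s) * ‖Z x‖ ^ s ∂P :=
        integral_mono (hZi.sub hTi).norm
          ((integrable_norm_rpow_of_memLp (by linarith) hZ).const_mul _)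
          fun x => norm_sub_truncNorm_le hM hs (Z x)
    _ = M ^ (1 - s) * ∫ x, ‖Z x‖ ^ s ∂P := integral_const_mul _ _

theorem integral_norm_truncNorm_rpow_le (hM : 0 ≤ M) (hs : 0 < s) (hsp : s ≤ p)
    (hZ : MemLp Z (.ofReal s) P) :
    ∫ x, ‖truncNorm M (Z x)‖ ^ p ∂P ≤ M ^ (p - s) * ∫ x, ‖Z x‖ ^ s ∂P := by
  rw [← integral_const_mul]
  exact integral_mono_of_nonneg (ae_of_all _ fun _ => by positivity)
    ((integrable_norm_rpow_of_memLp hs hZ).const_mul _)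
    (ae_of_all _ fun x => norm_truncNorm_rpow_le hM hs hsp (Z x))

theorem integral_norm_truncNorm_sq_le [IsProbabilityMeasure P] (hs : 2 ≤ s) (hA : 0 ≤ A)
    (hZ : AEStronglyMeasurable Z P) (h : eLpNorm Z (.ofReal s) P ≤ .ofReal A) (M : ℝ) :
    ∫ x, ‖truncNorm M (Z x)‖ ^ 2 ∂P ≤ A ^ 2 := by
  have hZ2 : MemLp Z (.ofReal s) P := ⟨hZ, h.trans_lt ENNReal.ofReal_lt_top⟩
  have h2 := integral_norm_rpow_le_of_eLpNorm_le two_pos hA hZ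
    ((eLpNorm_le_eLpNorm_of_exponent_le (ENNReal.ofReal_le_ofReal hs) hZ).trans h)
  simp only [Real.rpow_two] at h2
  refine le_trans (integral_mono_of_nonneg (ae_of_all _ fun _ => by positivity)
    (integrable_norm_sq_of_memLp hs hZ2) (ae_of_all _ fun x => ?_)) h2
  have := norm_truncNorm_le_norm M (Z x)
  dsimp only
  gcongr

/-- The size, up to the factor `rosenthalConst p`, of the `L^p` norm of a sum of at most `n` i.i.d.
centered vectors with `L^s` norm at most `A`, each truncated at norm `A * ℓ ^ (1 / s)`. -/
noncomputable def truncSumScale (n ℓ s p A : ℝ) : ℝ :=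
  A * (√n + (n / ℓ) ^ (1 / p) * ℓ ^ (1 / s))

theorem mul_sqrt_le_truncSumScale (hA : 0 ≤ A) (hn : 0 ≤ n) (hℓ : 0 ≤ ℓ) :
    A * √n ≤ truncSumScale n ℓ s p A := by
  unfold truncSumScale
  gcongr
  exact le_add_of_nonneg_right (by positivity)

theorem mul_rpow_le_truncSumScale (hA : 0 ≤ A) :
    A * ((n / ℓ) ^ (1 / p) * ℓ ^ (1 / s)) ≤ truncSumScale n ℓ s p A := by
  unfold truncSumScale
  gcongr
  exact le_add_of_nonneg_left (by positivity)

theorem mul_rpow_one_div_rpow_sub_mul_rpow (hA : 0 < A) (hℓ : 0 < ℓ) (hs : 0 < s) (a : ℝ) :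
    (A * ℓ ^ (1 / s)) ^ (a - s) * A ^ s = (A * ℓ ^ (1 / s)) ^ a / ℓ := by
  rw [Real.rpow_sub (by positivity), Real.mul_rpow hA.le (by positivity) (z := s),
    ← Real.rpow_mul hℓ.le, one_div_mul_cancel hs.ne', Real.rpow_one]
  field_simp

theorem mul_norm_integral_truncNorm_le_truncSumScale [NormedSpace ℝ F] [IsFiniteMeasure P]
    (hp : 1 ≤ p) (hs : 1 ≤ s) (hA : 0 < A) (hZ : AEStronglyMeasurable Z P)
    (hZA : eLpNorm Z (.ofReal s) P ≤ .ofReal A) (hmean : ∫ x, Z x ∂P = 0) (hn : 0 < n)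
    (hnℓ : n ≤ ℓ) :
    n * ‖∫ x, truncNorm (A * ℓ ^ (1 / s)) (Z x) ∂P‖ ≤ truncSumScale n ℓ s p A := by
  have hℓ : 0 < ℓ := by linarith
  have hbias := norm_integral_truncNorm_le (M := A * ℓ ^ (1 / s)) (by positivity) hs
    ⟨hZ, hZA.trans_lt ENNReal.ofReal_lt_top⟩ hmean
  calc n * ‖∫ x, truncNorm (A * ℓ ^ (1 / s)) (Z x) ∂P‖
      ≤ n * ((A * ℓ ^ (1 / s)) ^ (1 - s) * A ^ s) := by
        gcongr
        refine hbias.trans ?_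
        gcongr
        exact integral_norm_rpow_le_of_eLpNorm_le (by linarith) hA.le hZ hZA
    _ = A * ((n / ℓ) * ℓ ^ (1 / s)) := by
        rw [mul_rpow_one_div_rpow_sub_mul_rpow hA hℓ (by linarith), Real.rpow_one]
        ring
    _ ≤ A * ((n / ℓ) ^ (1 / p) * ℓ ^ (1 / s)) := by
        gcongr
        exact Real.self_le_rpow_of_le_one (by positivity) ((div_le_one hℓ).2 hnℓ)
          ((div_le_one (by linarith)).2 hp)
    _ ≤ truncSumScale n ℓ s p A := mul_rpow_le_truncSumScale hA.le

theorem mul_integral_norm_truncNorm_sq_le_truncSumScale [IsProbabilityMeasure P] (hs : 2 ≤ s)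
    (hA : 0 ≤ A) (hZ : AEStronglyMeasurable Z P) (hZA : eLpNorm Z (.ofReal s) P ≤ .ofReal A)
    (hn : 0 ≤ n) (hℓ : 0 ≤ ℓ) :
    n * ∫ x, ‖truncNorm M (Z x)‖ ^ 2 ∂P ≤ truncSumScale n ℓ s p A ^ 2 := by
  calc n * ∫ x, ‖truncNorm M (Z x)‖ ^ 2 ∂P
      ≤ n * A ^ 2 := by
        gcongr
        exact integral_norm_truncNorm_sq_le hs hA hZ hZA M
    _ = (A * √n) ^ 2 := by rw [mul_pow, Real.sq_sqrt hn, mul_comm]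
    _ ≤ truncSumScale n ℓ s p A ^ 2 := by
        gcongr
        exact mul_sqrt_le_truncSumScale hA hn hℓ

theorem mul_integral_norm_truncNorm_rpow_le_truncSumScale (hs : 0 < s) (hsp : s ≤ p) (hA : 0 < A)
    (hZ : AEStronglyMeasurable Z P) (hZA : eLpNorm Z (.ofReal s) P ≤ .ofReal A) (hn : 0 ≤ n)
    (hℓ : 0 < ℓ) :
    n * ∫ x, ‖truncNorm (A * ℓ ^ (1 / s)) (Z x)‖ ^ p ∂P ≤ truncSumScale n ℓ s p A ^ p := by
  have hM : 0 < A * ℓ ^ (1 / s) := by positivity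
  have hp : 0 < p := by linarith
  calc n * ∫ x, ‖truncNorm (A * ℓ ^ (1 / s)) (Z x)‖ ^ p ∂P
      ≤ n * ((A * ℓ ^ (1 / s)) ^ (p - s) * A ^ s) := by
        gcongr
        refine (integral_norm_truncNorm_rpow_le hM.le hs hsp
          ⟨hZ, hZA.trans_lt ENNReal.ofReal_lt_top⟩).trans ?_
        gcongr
        exact integral_norm_rpow_le_of_eLpNorm_le hs hA.le hZ hZA
    _ = (A * ((n / ℓ) ^ (1 / p) * ℓ ^ (1 / s))) ^ p := by
        rw [mul_rpow_one_div_rpow_sub_mul_rpow hA hℓ hs, mul_left_comm A,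
          Real.mul_rpow (by positivity) hM.le, ← Real.rpow_mul (by positivity),
          one_div_mul_cancel hp.ne', Real.rpow_one]
        ring
    _ ≤ truncSumScale n ℓ s p A ^ p := by
        gcongr
        exact mul_rpow_le_truncSumScale hA.le

theorem integral_norm_sum_truncNorm_rpow_le [InnerProductSpace ℝ F] [CompleteSpace F]
    [IsProbabilityMeasure P] (hp : 3 ≤ p) (hs : 2 ≤ s) (hsp : s ≤ p) (hA : 0 < A)
    (hZ : AEStronglyMeasurable Z P) (hZA : eLpNorm Z (.ofReal s) P ≤ .ofReal A)
    (hmean : ∫ x, Z x ∂P = 0) (hn : 0 < n) (hnℓ : n ≤ ℓ) {N : ℕ} (hN : N ≤ n) :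
    ∫ z, ‖∑ j, truncNorm (A * ℓ ^ (1 / s)) (Z (z j))‖ ^ p ∂(Measure.pi fun _ : Fin N => P)
      ≤ (rosenthalConst p * truncSumScale n ℓ s p A) ^ p := by
  have hℓ : 0 < ℓ := by linarith
  have hK := one_le_rosenthalConst (p := p) (by linarith)
  have hD : 0 ≤ truncSumScale n ℓ s p A :=
    le_trans (by positivity) (mul_sqrt_le_truncSumScale hA.le hn.le hℓ.le)
  refine (integral_norm_sum_rpow_le hn hp (mul_nonneg (by linarith) hD)
    (memLp_truncNorm (by positivity) hZ _) ?_ ?_ ?_ hN).trans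
    (mul_le_of_le_one_left (by positivity) ((div_le_one hn).2 hN))
  · rw [mul_assoc]
    gcongr
    exact mul_norm_integral_truncNorm_le_truncSumScale (by linarith) (by linarith) hA hZ hZA hmean
      hn hnℓ
  · rw [mul_assoc, mul_pow]
    gcongr
    exacts [le_self_pow₀ hK two_ne_zero,
      mul_integral_norm_truncNorm_sq_le_truncSumScale hs hA.le hZ hZA hn.le hℓ.le]
  · rw [mul_assoc, Real.mul_rpow (by linarith) hD]
    gcongr
    exacts [Real.self_le_rpow_of_one_le hK (by linarith),
      mul_integral_norm_truncNorm_rpow_le_truncSumScale (by linarith) hsp hA hZ hZA hn.le hℓ]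

end Truncation

section Lattice

variable {ι V : Type*} [AddCommGroup V] [Module ℝ V]

-- Rounding at random, with mean `x`, has variance at most `1 / 4`.
theorem exists_int_mul_sub_add_mul_sub_sq_le (x b : ℝ) {c q : ℝ} (hq : 0 ≤ q) (hcq : c ≤ q) :
    ∃ k : ℤ, |k - x| ≤ 1 ∧ (k - x) * b + (k - x) * (k - x) * c ≤ q / 4 := by
  have hr0 := Int.fract_nonneg x
  have hr1 := Int.fract_lt_one x
  have hfloor : (⌊x⌋ : ℝ) - x = -Int.fract x := by
    linarith [Int.floor_add_fract x]
  have hceil : ((⌊x⌋ + 1 : ℤ) : ℝ) - x = 1 - Int.fract x := by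
    push_cast
    linarith [Int.floor_add_fract x]
  set r := Int.fract x
  have hmean : (1 - r) * (-r * b + -r * -r * c) + r * ((1 - r) * b + (1 - r) * (1 - r) * c)
      ≤ q / 4 := by
    have : r * (1 - r) * c ≤ r * (1 - r) * q := by
      have : 0 ≤ 1 - r := by linarith
      gcongr
    nlinarith [mul_nonneg hq (sq_nonneg (2 * r - 1))]
  by_contra! hno
  have h0 := hno ⌊x⌋ (by rw [hfloor, abs_neg, abs_of_nonneg hr0]; exact hr1.le)
  have h1 := hno (⌊x⌋ + 1) (by rw [hceil, abs_of_nonneg (by linarith)]; linarith)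
  rw [hfloor] at h0
  rw [hceil] at h1
  nlinarith [mul_pos (sub_pos.2 hr1) (sub_pos.2 h0), mul_nonneg hr0 (sub_pos.2 h1).le]

theorem exists_int_sum_smul_le (Q : QuadraticForm ℝ V) (b : ι → V) (x : ι → ℝ) {q : ι → ℝ}
    (hq : ∀ a, 0 ≤ q a) (hQ : ∀ a, Q (b a) ≤ q a) (s : Finset ι) (y : V) :
    ∃ k : ι → ℤ, (∀ a ∈ s, |k a - x a| ≤ 1) ∧
      Q (y + ∑ a ∈ s, (k a : ℝ) • b a) ≤ Q (y + ∑ a ∈ s, x a • b a) + (∑ a ∈ s, q a) / 4 := by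
  classical
  induction s using Finset.induction_on generalizing y with
  | empty => exact ⟨0, by simp⟩
  | insert i s his ih =>
    set z := y + (x i • b i + ∑ a ∈ s, x a • b a) with hz
    obtain ⟨m, hm, hQm⟩ := exists_int_mul_sub_add_mul_sub_sq_le (x i)
      (QuadraticMap.polar Q z (b i)) (hq i) (hQ i)
    obtain ⟨k, hk, hQk⟩ := ih (y + (m : ℝ) • b i)
    have hstep : y + (m : ℝ) • b i + ∑ a ∈ s, x a • b a = z + (m - x i) • b i := by
      rw [hz, sub_smul]
      abel
    have hk_eq : ∑ a ∈ s, ((Function.update k i m a : ℤ) : ℝ) • b a = ∑ a ∈ s, (k a : ℝ) • b a :=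
      Finset.sum_congr rfl fun a ha => by
        rw [Function.update_of_ne (ne_of_mem_of_not_mem ha his)]
    refine ⟨Function.update k i m, ?_, ?_⟩
    · intro a ha
      rcases Finset.mem_insert.1 ha with rfl | has
      · rwa [Function.update_self]
      · rw [Function.update_of_ne (ne_of_mem_of_not_mem has his)]
        exact hk a has
    · rw [hstep, QuadraticMap.map_add Q z, QuadraticMap.polar_smul_right, QuadraticMap.map_smul,
        smul_eq_mul, smul_eq_mul] at hQk
      rw [Finset.sum_insert his, Finset.sum_insert his, Finset.sum_insert his, hk_eq,
        Function.update_self, ← add_assoc]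
      linarith

theorem sum_Icc_exp_neg_sq_div_two_le (B : ℕ) :
    ∑ k ∈ Finset.Icc (-(B : ℤ)) B, Real.exp (-((k : ℝ) ^ 2 / 2)) ≤ Real.exp 2 := by
  have hbase : Real.exp (-(1 / 2)) ≤ 2 / 3 := by
    rw [Real.exp_neg]
    refine inv_le_of_inv_le₀ (by norm_num) ?_
    linarith [Real.add_one_le_exp (1 / 2 : ℝ)]
  have hterm (n : ℕ) : Real.exp (-((n + 1 : ℝ) ^ 2 / 2)) ≤ (2 / 3) ^ (n + 1) := by
    calc Real.exp (-((n + 1 : ℝ) ^ 2 / 2)) ≤ Real.exp ((n + 1 : ℕ) * (-(1 / 2))) := by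
          gcongr
          push_cast
          nlinarith [(Nat.cast_nonneg n : (0 : ℝ) ≤ n)]
      _ = Real.exp (-(1 / 2)) ^ (n + 1) := Real.exp_nat_mul _ _
      _ ≤ _ := by gcongr
  have hfive : 5 ≤ Real.exp 2 := by
    rw [← one_add_one_eq_two, Real.exp_add]
    nlinarith [Real.exp_one_gt_d9]
  have hgeom : ∑ k ∈ Finset.Icc (-(B : ℤ)) B, Real.exp (-((k : ℝ) ^ 2 / 2))
      ≤ 5 - 4 * (2 / 3) ^ B := by
    induction B with
    | zero => norm_num
    | succ B ih =>
      have hIcc : Finset.Icc (-((B + 1 : ℕ) : ℤ)) ((B + 1 : ℕ) : ℤ) =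
          insert ((B : ℤ) + 1) (insert (-((B : ℤ) + 1)) (Finset.Icc (-(B : ℤ)) B)) := by
        ext k
        simp only [Finset.mem_Icc, Finset.mem_insert]
        omega
      rw [hIcc, Finset.sum_insert (by simp; omega), Finset.sum_insert (by simp)]
      push_cast
      rw [neg_sq]
      have hB := hterm B
      rw [pow_succ (2 / 3 : ℝ)] at hB ⊢
      linarith
  have : (0 : ℝ) ≤ (2 / 3) ^ B := by positivity
  linarith

theorem sum_piFinset_Icc_exp_neg_sum_sq_div_two_le (d B : ℕ) :
    ∑ k ∈ Fintype.piFinset fun _ : Fin d => Finset.Icc (-(B : ℤ)) B,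
      Real.exp (-((∑ a, (k a : ℝ) ^ 2) / 2)) ≤ Real.exp (2 * d) := by
  calc ∑ k ∈ Fintype.piFinset fun _ : Fin d => Finset.Icc (-(B : ℤ)) B,
        Real.exp (-((∑ a, (k a : ℝ) ^ 2) / 2))
      = ∏ _a : Fin d, ∑ k ∈ Finset.Icc (-(B : ℤ)) B, Real.exp (-((k : ℝ) ^ 2 / 2)) := by
        rw [← Finset.sum_prod_piFinset (Finset.Icc (-(B : ℤ)) B)
          fun _ k => Real.exp (-((k : ℝ) ^ 2 / 2))]
        simp only [← Real.exp_sum, Finset.sum_neg_distrib, Finset.sum_div]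
    _ ≤ ∏ _a : Fin d, Real.exp 2 := by
        gcongr
        exact sum_Icc_exp_neg_sq_div_two_le B
    _ = Real.exp (2 * d) := by
        rw [Finset.prod_const, Finset.card_univ, Fintype.card_fin, ← Real.exp_nat_mul, mul_comm]

end Lattice

/-- A random vector of `ℝᵈ` with identity second moment matrix, whose fourth moment in every unit
direction is at most `H`. -/
structure IsotropicFourthMoment {E : Type*} [MeasurableSpace E] {d : ℕ} (P : Measure E)
    (W : E → EuclideanSpace ℝ (Fin d)) (H : ℝ) : Prop where
  memLp : MemLp W 4 P
  integral_inner_sq : ∀ u, ∫ x, inner ℝ u (W x) ^ 2 ∂P = ‖u‖ ^ 2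
  integral_inner_pow_four_le : ∀ u, ∫ x, inner ℝ u (W x) ^ 4 ∂P ≤ H * ‖u‖ ^ 4

section Isotropic

variable {E : Type*} [MeasurableSpace E] {P : Measure E} {d : ℕ}
  {W : E → EuclideanSpace ℝ (Fin d)} {H M : ℝ}

theorem inner_truncNorm_sq_le {F : Type*} [NormedAddCommGroup F] [InnerProductSpace ℝ F] (M : ℝ)
    (u z : F) : inner ℝ u (truncNorm M z) ^ 2 ≤ inner ℝ u z ^ 2 := by
  unfold truncNorm
  split_ifs
  · exact le_rfl
  · rw [inner_zero_right, zero_pow two_ne_zero]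
    positivity

theorem inner_sq_sub_div_le_inner_truncNorm_sq {F : Type*} [NormedAddCommGroup F]
    [InnerProductSpace ℝ F] (hM : 0 < M) (u z : F) :
    inner ℝ u z ^ 2 - inner ℝ u z ^ 2 * ‖z‖ ^ 2 / M ^ 2 ≤ inner ℝ u (truncNorm M z) ^ 2 := by
  unfold truncNorm
  split_ifs with h
  · exact sub_le_self _ (by positivity)
  · rw [inner_zero_right, mul_div_assoc]
    have : 1 ≤ ‖z‖ ^ 2 / M ^ 2 := by
      rw [one_le_div (by positivity)]
      gcongr
      exact (not_le.1 h).le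
    nlinarith [sq_nonneg (inner ℝ u z)]

theorem norm_pow_four_le_card_mul_sum (z : EuclideanSpace ℝ (Fin d)) :
    ‖z‖ ^ 4 ≤ d * ∑ a, z a ^ 4 := by
  calc ‖z‖ ^ 4 = (∑ a, z a ^ 2) ^ 2 := by rw [← EuclideanSpace.real_norm_sq_eq]; ring
    _ ≤ d * ∑ a, (z a ^ 2) ^ 2 := by
      simpa using sq_sum_le_card_mul_sum_sq (s := Finset.univ) (f := fun a => z a ^ 2)
    _ = d * ∑ a, z a ^ 4 := by simp only [← pow_mul, Nat.reduceMul]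

theorem integrable_norm_truncNorm_pow [IsFiniteMeasure P] {F : Type*} [NormedAddCommGroup F]
    {Z : E → F} (hM : 0 ≤ M) (hZ : AEStronglyMeasurable Z P) (k : ℕ) :
    Integrable (fun x => ‖truncNorm M (Z x)‖ ^ k) P :=
  (memLp_truncNorm hM hZ k).integrable_norm_pow'

theorem integrable_inner_truncNorm_pow [IsFiniteMeasure P] {F : Type*} [NormedAddCommGroup F]
    [InnerProductSpace ℝ F] {Z : E → F} (hM : 0 ≤ M) (hZ : AEStronglyMeasurable Z P) (u : F)
    (k : ℕ) : Integrable (fun x => inner ℝ u (truncNorm M (Z x)) ^ k) P := by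
  have hmem : MemLp (fun x => inner ℝ u (truncNorm M (Z x))) k P :=
    (memLp_truncNorm hM hZ k).const_inner u
  exact hmem.integrable_norm_pow'.mono (hmem.1.pow k) (ae_of_all _ fun x => by simp)

namespace IsotropicFourthMoment

theorem integrable_inner_pow_four (h : IsotropicFourthMoment P W H)
    (u : EuclideanSpace ℝ (Fin d)) : Integrable (fun x => inner ℝ u (W x) ^ 4) P := by
  have hmem : MemLp (fun x => inner ℝ u (W x)) (4 : ℕ) P := h.memLp.const_inner u
  simpa only [Real.norm_eq_abs, Even.pow_abs ⟨2, rfl⟩] using hmem.integrable_norm_pow four_ne_zero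

theorem integral_apply_sq (h : IsotropicFourthMoment P W H) (a : Fin d) :
    ∫ x, W x a ^ 2 ∂P = 1 := by
  simpa [EuclideanSpace.inner_single_left] using h.integral_inner_sq (EuclideanSpace.single a 1)

theorem integral_apply_pow_four_le (h : IsotropicFourthMoment P W H) (a : Fin d) :
    ∫ x, W x a ^ 4 ∂P ≤ H := by
  simpa [EuclideanSpace.inner_single_left] using
    h.integral_inner_pow_four_le (EuclideanSpace.single a 1)

theorem integrable_apply_pow_four (h : IsotropicFourthMoment P W H) (a : Fin d) :
    Integrable (fun x => W x a ^ 4) P := by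
  simpa [EuclideanSpace.inner_single_left] using
    h.integrable_inner_pow_four (EuclideanSpace.single a 1)

theorem integral_norm_pow_four_le (h : IsotropicFourthMoment P W H) :
    ∫ x, ‖W x‖ ^ 4 ∂P ≤ H * d ^ 2 := by
  calc ∫ x, ‖W x‖ ^ 4 ∂P ≤ ∫ x, d * ∑ a, W x a ^ 4 ∂P :=
        integral_mono (h.memLp.integrable_norm_pow four_ne_zero)
          ((integrable_finsetSum _ fun a _ => h.integrable_apply_pow_four a).const_mul _)
          fun x => norm_pow_four_le_card_mul_sum (W x)
    _ = d * ∑ a, ∫ x, W x a ^ 4 ∂P := by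
        rw [integral_const_mul, integral_finsetSum _ fun a _ => h.integrable_apply_pow_four a]
    _ ≤ d * ∑ _a : Fin d, H := by
        gcongr with a
        exact h.integral_apply_pow_four_le a
    _ = H * d ^ 2 := by
        rw [Finset.sum_const, Finset.card_univ, Fintype.card_fin, nsmul_eq_mul]
        ring

theorem integral_inner_sq_mul_norm_sq_le (h : IsotropicFourthMoment P W H)
    (u : EuclideanSpace ℝ (Fin d)) :
    ∫ x, inner ℝ u (W x) ^ 2 * ‖W x‖ ^ 2 ∂P ≤ H * d * ‖u‖ ^ 2 := by
  rcases eq_or_ne u 0 with rfl | hu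
  · simp
  have hu' : 0 < ‖u‖ ^ 2 := by positivity
  have hpoint (x : E) : inner ℝ u (W x) ^ 2 * ‖W x‖ ^ 2
      ≤ ∑ a, (inner ℝ u (W x) ^ 4 / ‖u‖ ^ 2 + ‖u‖ ^ 2 * W x a ^ 4) / 2 := by
    rw [EuclideanSpace.real_norm_sq_eq, Finset.mul_sum]
    refine Finset.sum_le_sum fun a _ => ?_
    have := sq_nonneg (inner ℝ u (W x) ^ 2 - ‖u‖ ^ 2 * W x a ^ 2)
    rw [← sub_nonneg]
    refine (div_nonneg this (mul_pos two_pos hu').le).trans_eq ?_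
    field_simp
    ring
  have hint (a : Fin d) :
      Integrable (fun x => inner ℝ u (W x) ^ 4 / ‖u‖ ^ 2 + ‖u‖ ^ 2 * W x a ^ 4) P :=
    ((h.integrable_inner_pow_four u).div_const _).add ((h.integrable_apply_pow_four a).const_mul _)
  calc ∫ x, inner ℝ u (W x) ^ 2 * ‖W x‖ ^ 2 ∂P
      ≤ ∑ a, ((∫ x, inner ℝ u (W x) ^ 4 ∂P) / ‖u‖ ^ 2 + ‖u‖ ^ 2 * ∫ x, W x a ^ 4 ∂P) / 2 := by
        refine (integral_mono_of_nonneg (ae_of_all _ fun _ => by positivity)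
          (integrable_finsetSum _ fun a _ => (hint a).div_const 2)
          (ae_of_all _ hpoint)).trans_eq ?_
        rw [integral_finsetSum _ fun a _ => (hint a).div_const 2]
        refine Finset.sum_congr rfl fun a _ => ?_
        rw [integral_div, integral_add ((h.integrable_inner_pow_four u).div_const _)
          ((h.integrable_apply_pow_four a).const_mul _), integral_div, integral_const_mul]
    _ ≤ ∑ _a : Fin d, (H * ‖u‖ ^ 4 / ‖u‖ ^ 2 + ‖u‖ ^ 2 * H) / 2 := by
        gcongr with a
        exacts [h.integral_inner_pow_four_le u, h.integral_apply_pow_four_le a]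
    _ = H * d * ‖u‖ ^ 2 := by
        rw [Finset.sum_const, Finset.card_univ, Fintype.card_fin, nsmul_eq_mul]
        field_simp
        ring

theorem integral_norm_truncNorm_pow_four_le (h : IsotropicFourthMoment P W H) (M : ℝ) :
    ∫ x, ‖truncNorm M (W x)‖ ^ 4 ∂P ≤ H * d ^ 2 := by
  refine le_trans (integral_mono_of_nonneg (ae_of_all _ fun _ => by positivity)
    (h.memLp.integrable_norm_pow four_ne_zero) (ae_of_all _ fun x => ?_))
    h.integral_norm_pow_four_le
  have := norm_truncNorm_le_norm M (W x)
  dsimp only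
  gcongr

theorem integral_inner_truncNorm_pow_four_le (h : IsotropicFourthMoment P W H) (M : ℝ)
    (u : EuclideanSpace ℝ (Fin d)) :
    ∫ x, inner ℝ u (truncNorm M (W x)) ^ 4 ∂P ≤ H * ‖u‖ ^ 4 := by
  refine le_trans (integral_mono_of_nonneg (ae_of_all _ fun _ => by positivity)
    (h.integrable_inner_pow_four u) (ae_of_all _ fun x => ?_)) (h.integral_inner_pow_four_le u)
  have := inner_truncNorm_sq_le M u (W x)
  have : (inner ℝ u (truncNorm M (W x)) ^ 2) ^ 2 ≤ (inner ℝ u (W x) ^ 2) ^ 2 := by gcongr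
  simpa only [← pow_mul] using this

variable [IsFiniteMeasure P]

theorem integrable_norm_sq (h : IsotropicFourthMoment P W H) :
    Integrable (fun x => ‖W x‖ ^ 2) P :=
  (h.memLp.mono_exponent (by norm_num)).integrable_norm_pow two_ne_zero

theorem integrable_inner_sq (h : IsotropicFourthMoment P W H) (u : EuclideanSpace ℝ (Fin d)) :
    Integrable (fun x => inner ℝ u (W x) ^ 2) P :=
  ((h.memLp.mono_exponent (by norm_num)).const_inner u).integrable_sq

theorem integral_norm_sq (h : IsotropicFourthMoment P W H) : ∫ x, ‖W x‖ ^ 2 ∂P = d := by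
  have hint (a : Fin d) : Integrable (fun x => W x a ^ 2) P := by
    simpa [EuclideanSpace.inner_single_left] using
      h.integrable_inner_sq (EuclideanSpace.single a 1)
  simp only [EuclideanSpace.real_norm_sq_eq]
  rw [integral_finsetSum _ fun a _ => hint a]
  simp [h.integral_apply_sq]

theorem le_integral_inner_truncNorm_sq (h : IsotropicFourthMoment P W H) (hM : 0 < M)
    (u : EuclideanSpace ℝ (Fin d)) :
    (1 - H * d / M ^ 2) * ‖u‖ ^ 2 ≤ ∫ x, inner ℝ u (truncNorm M (W x)) ^ 2 ∂P := by
  have hmem := h.memLp.const_inner (𝕜 := ℝ) u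
  have hint : Integrable (fun x => inner ℝ u (W x) ^ 2 * ‖W x‖ ^ 2) P := by
    refine ((h.memLp.integrable_norm_pow four_ne_zero).const_mul (‖u‖ ^ 2)).mono'
      ((hmem.1.pow 2).mul (h.memLp.1.norm.pow 2)) (ae_of_all _ fun x => ?_)
    rw [Real.norm_of_nonneg (by positivity), ← sq_abs]
    calc |inner ℝ u (W x)| ^ 2 * ‖W x‖ ^ 2 ≤ (‖u‖ * ‖W x‖) ^ 2 * ‖W x‖ ^ 2 := by
          gcongr
          exact abs_real_inner_le_norm u (W x)
      _ = ‖u‖ ^ 2 * ‖W x‖ ^ 4 := by ring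
  calc (1 - H * d / M ^ 2) * ‖u‖ ^ 2
      ≤ ∫ x, inner ℝ u (W x) ^ 2 ∂P - (∫ x, inner ℝ u (W x) ^ 2 * ‖W x‖ ^ 2 ∂P) / M ^ 2 := by
        rw [h.integral_inner_sq, sub_mul, one_mul, div_mul_eq_mul_div]
        gcongr
        exact h.integral_inner_sq_mul_norm_sq_le u
    _ = ∫ x, (inner ℝ u (W x) ^ 2 - inner ℝ u (W x) ^ 2 * ‖W x‖ ^ 2 / M ^ 2) ∂P := by
        rw [integral_sub (h.integrable_inner_sq u) (hint.div_const _), integral_div]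
    _ ≤ ∫ x, inner ℝ u (truncNorm M (W x)) ^ 2 ∂P :=
        integral_mono ((h.integrable_inner_sq u).sub (hint.div_const _))
          (integrable_inner_truncNorm_pow hM.le h.memLp.1 u 2)
          fun x => inner_sq_sub_div_le_inner_truncNorm_sq hM u (W x)

theorem integral_norm_truncNorm_sq_le (h : IsotropicFourthMoment P W H) (M : ℝ) :
    ∫ x, ‖truncNorm M (W x)‖ ^ 2 ∂P ≤ d := by
  rw [← h.integral_norm_sq]
  refine integral_mono_of_nonneg (ae_of_all _ fun _ => by positivity) h.integrable_norm_sq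
    (ae_of_all _ fun x => ?_)
  have := norm_truncNorm_le_norm M (W x)
  dsimp only
  gcongr

end IsotropicFourthMoment

/-- The truncation level for isotropic vectors with fourth moments at most `H`: it removes a
fraction `1 / 128` of the second moment in any direction. -/
noncomputable def isotropicTruncLevel (d : ℕ) (H : ℝ) : ℝ :=
  √(128 * H * d)

/-- The exponent of the Chernoff bound for `∑ j, ⟪u, Wⱼ⟫ ^ 2` from below, as a function of the
truncated vector `z`. The multiple of `‖z‖ ^ 2` is there to pay for moving `u` to a lattice. -/
noncomputable def chernoffExponent (H : ℝ) (u z : EuclideanSpace ℝ (Fin d)) : ℝ :=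
  (‖z‖ ^ 2 / (16 * d) - inner ℝ u z ^ 2) / (8 * H)

/-- The lower bound for `-8 * H * E (chernoffExponent H u)` of the truncated vector, as a function
of `s = ‖u‖ ^ 2`, minus the second-order term of the exponential. -/
noncomputable def chernoffRate (s : ℝ) : ℝ :=
  127 / 128 * s - s ^ 2 / 8 - 1 / 15

theorem exp_le_one_add_add_sq {v : ℝ} (hv : v ≤ 1) : Real.exp v ≤ 1 + v + v ^ 2 := by
  rcases le_total (-1) v with h | h
  · linarith [le_of_abs_le (Real.abs_exp_sub_one_sub_id_le (abs_le.2 ⟨h, hv⟩))]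
  · have : Real.exp v ≤ 1 := Real.exp_le_one_iff.2 (by linarith)
    nlinarith

theorem isotropicTruncLevel_sq (hH : 0 ≤ H) : isotropicTruncLevel d H ^ 2 = 128 * H * d :=
  Real.sq_sqrt (by positivity)

theorem isotropicTruncLevel_pos (hd : 0 < d) (hH : 0 < H) : 0 < isotropicTruncLevel d H := by
  unfold isotropicTruncLevel
  positivity

theorem chernoffExponent_le_one (hH : 0 < H) (u : EuclideanSpace ℝ (Fin d))
    {z : EuclideanSpace ℝ (Fin d)} (hz : ‖z‖ ≤ isotropicTruncLevel d H) :
    chernoffExponent H u z ≤ 1 := by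
  have hz2 : ‖z‖ ^ 2 ≤ 128 * H * d := by
    rw [← isotropicTruncLevel_sq hH.le]
    gcongr
  have : ‖z‖ ^ 2 / (16 * d) ≤ 8 * H := div_le_of_le_mul₀ (by positivity) (by positivity)
    (by linarith)
  unfold chernoffExponent
  rw [div_le_one (by positivity)]
  linarith [sq_nonneg (inner ℝ u z)]

theorem chernoffExponent_sq_le (u z : EuclideanSpace ℝ (Fin d)) :
    chernoffExponent H u z ^ 2
      ≤ (‖z‖ ^ 4 / (16 * d) ^ 2 + inner ℝ u z ^ 4) / (8 * H) ^ 2 := by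
  unfold chernoffExponent
  rw [div_pow]
  gcongr
  have : 0 ≤ ‖z‖ ^ 2 / (16 * d) * inner ℝ u z ^ 2 := by positivity
  calc (‖z‖ ^ 2 / (16 * d) - inner ℝ u z ^ 2) ^ 2
      ≤ (‖z‖ ^ 2 / (16 * d)) ^ 2 + (inner ℝ u z ^ 2) ^ 2 := by nlinarith
    _ = ‖z‖ ^ 4 / (16 * d) ^ 2 + inner ℝ u z ^ 4 := by rw [div_pow]; simp only [← pow_mul]

namespace IsotropicFourthMoment

variable [IsProbabilityMeasure P]

theorem integral_chernoffExponent_le (h : IsotropicFourthMoment P W H) (hd : 0 < d) (hH : 0 < H)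
    (u : EuclideanSpace ℝ (Fin d)) :
    ∫ x, chernoffExponent H u (truncNorm (isotropicTruncLevel d H) (W x)) ∂P
      ≤ (1 / 16 - 127 / 128 * ‖u‖ ^ 2) / (8 * H) := by
  have hM := isotropicTruncLevel_pos hd hH
  have hint := integrable_norm_truncNorm_pow hM.le h.memLp.1 2
  have hlow := h.le_integral_inner_truncNorm_sq hM u
  rw [isotropicTruncLevel_sq hH.le] at hlow
  have hratio : 1 - H * d / (128 * H * d) = 127 / 128 := by
    field_simp
    norm_num
  rw [hratio] at hlow
  unfold chernoffExponent
  rw [integral_div, integral_sub (hint.div_const _)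
    (integrable_inner_truncNorm_pow hM.le h.memLp.1 u 2), integral_div]
  have hnorm : (∫ x, ‖truncNorm (isotropicTruncLevel d H) (W x)‖ ^ 2 ∂P) / (16 * d) ≤ 1 / 16 := by
    rw [div_le_div_iff₀ (by positivity) (by positivity)]
    linarith [h.integral_norm_truncNorm_sq_le (isotropicTruncLevel d H)]
  gcongr

theorem integrable_chernoffExponent (h : IsotropicFourthMoment P W H) (hM : 0 ≤ M)
    (u : EuclideanSpace ℝ (Fin d)) :
    Integrable (fun x => chernoffExponent H u (truncNorm M (W x))) P :=
  (((integrable_norm_truncNorm_pow hM h.memLp.1 2).div_const _).sub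
    (integrable_inner_truncNorm_pow hM h.memLp.1 u 2)).div_const _

theorem integral_chernoffExponent_sq_le (h : IsotropicFourthMoment P W H) (hd : 0 < d)
    (hM : 0 ≤ M) (u : EuclideanSpace ℝ (Fin d)) :
    ∫ x, chernoffExponent H u (truncNorm M (W x)) ^ 2 ∂P
      ≤ (1 / 256 + ‖u‖ ^ 4) / 8 / (8 * H) := by
  have hint1 := integrable_norm_truncNorm_pow hM h.memLp.1 4
  have hint2 := integrable_inner_truncNorm_pow hM h.memLp.1 u 4
  calc ∫ x, chernoffExponent H u (truncNorm M (W x)) ^ 2 ∂P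
      ≤ ∫ x, (‖truncNorm M (W x)‖ ^ 4 / (16 * d) ^ 2 + inner ℝ u (truncNorm M (W x)) ^ 4)
          / (8 * H) ^ 2 ∂P :=
        integral_mono_of_nonneg (ae_of_all _ fun _ => sq_nonneg _)
          (((hint1.div_const _).add hint2).div_const _)
          (ae_of_all _ fun x => chernoffExponent_sq_le u _)
    _ = ((∫ x, ‖truncNorm M (W x)‖ ^ 4 ∂P) / (16 * d) ^ 2
          + ∫ x, inner ℝ u (truncNorm M (W x)) ^ 4 ∂P) / (8 * H) ^ 2 := by
        rw [integral_div, integral_add (hint1.div_const _) hint2, integral_div]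
    _ ≤ (H * d ^ 2 / (16 * d) ^ 2 + H * ‖u‖ ^ 4) / (8 * H) ^ 2 := by
        gcongr
        exacts [h.integral_norm_truncNorm_pow_four_le M,
          h.integral_inner_truncNorm_pow_four_le M u]
    _ = (1 / 256 + ‖u‖ ^ 4) / 8 / (8 * H) := by
        rcases eq_or_ne H 0 with rfl | hH
        · simp
        · field_simp
          ring

theorem integrable_chernoffExponent_sq (h : IsotropicFourthMoment P W H) (hM : 0 ≤ M)
    (u : EuclideanSpace ℝ (Fin d)) :
    Integrable (fun x => chernoffExponent H u (truncNorm M (W x)) ^ 2) P := by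
  refine ((((integrable_norm_truncNorm_pow hM h.memLp.1 4).div_const ((16 * d) ^ 2)).add
    (integrable_inner_truncNorm_pow hM h.memLp.1 u 4)).div_const ((8 * H) ^ 2)).mono'
    ((h.integrable_chernoffExponent hM u).1.pow 2) (ae_of_all _ fun x => ?_)
  rw [Real.norm_of_nonneg (sq_nonneg _)]
  exact chernoffExponent_sq_le u _

theorem integral_exp_chernoffExponent_le (h : IsotropicFourthMoment P W H) (hd : 0 < d)
    (hH : 0 < H) (u : EuclideanSpace ℝ (Fin d)) :
    ∫ x, Real.exp (chernoffExponent H u (truncNorm (isotropicTruncLevel d H) (W x))) ∂P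
      ≤ Real.exp (-(chernoffRate (‖u‖ ^ 2) / (8 * H))) := by
  set M := isotropicTruncLevel d H
  have hM : 0 ≤ M := (isotropicTruncLevel_pos hd hH).le
  set φ := fun x => chernoffExponent H u (truncNorm M (W x))
  have hφ1 (x : E) : φ x ≤ 1 := chernoffExponent_le_one hH u (norm_truncNorm_le hM (W x))
  have hφ : Integrable φ P := h.integrable_chernoffExponent hM u
  have hφ2 : Integrable (fun x => φ x ^ 2) P := h.integrable_chernoffExponent_sq hM u
  have h1φ : Integrable (fun x => 1 + φ x) P := (integrable_const 1).add hφ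
  calc ∫ x, Real.exp (φ x) ∂P ≤ ∫ x, (1 + φ x + φ x ^ 2) ∂P :=
        integral_mono_of_nonneg (ae_of_all _ fun _ => (Real.exp_pos _).le)
          (h1φ.add hφ2)
          (ae_of_all _ fun x => exp_le_one_add_add_sq (hφ1 x))
    _ = 1 + ∫ x, φ x ∂P + ∫ x, φ x ^ 2 ∂P := by
        rw [integral_add h1φ hφ2, integral_add (integrable_const 1) hφ,
          integral_const, probReal_univ, one_smul]
    _ ≤ 1 + (1 / 16 - 127 / 128 * ‖u‖ ^ 2) / (8 * H) + (1 / 256 + ‖u‖ ^ 4) / 8 / (8 * H) := by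
        gcongr
        exacts [h.integral_chernoffExponent_le hd hH u, h.integral_chernoffExponent_sq_le hd hM u]
    _ ≤ -(chernoffRate (‖u‖ ^ 2) / (8 * H)) + 1 := by
        unfold chernoffRate
        rw [add_assoc, ← add_div, add_comm, ← neg_div]
        gcongr
        linarith
    _ ≤ Real.exp (-(chernoffRate (‖u‖ ^ 2) / (8 * H))) := Real.add_one_le_exp _

theorem integrable_exp_chernoffExponent (h : IsotropicFourthMoment P W H) (hd : 0 < d)
    (hH : 0 < H) (u : EuclideanSpace ℝ (Fin d)) :
    Integrable
      (fun x => Real.exp (chernoffExponent H u (truncNorm (isotropicTruncLevel d H) (W x)))) P := by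
  have hM := isotropicTruncLevel_pos hd hH
  refine .of_bound (Real.continuous_exp.comp_aestronglyMeasurable
    (h.integrable_chernoffExponent hM.le u).1) (Real.exp 1) (ae_of_all _ fun x => ?_)
  rw [Real.norm_of_nonneg (Real.exp_pos _).le]
  exact Real.exp_le_exp.2 (chernoffExponent_le_one hH u (norm_truncNorm_le hM.le (W x)))

end IsotropicFourthMoment

end Isotropic

theorem measure_pi_le_sum_le_exp_neg {E : Type*} [MeasurableSpace E] {P : Measure E}
    [IsProbabilityMeasure P] {f : E → ℝ} {κ : ℝ} (hf : Integrable (fun x => Real.exp (f x)) P)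
    (hκ : ∫ x, Real.exp (f x) ∂P ≤ Real.exp (-κ)) (N : ℕ) (c : ℝ) :
    Measure.pi (fun _ : Fin N => P) {z | c - N * κ ≤ ∑ j, f (z j)}
      ≤ ENNReal.ofReal (Real.exp (-c)) := by
  have hprod : (fun z : Fin N → E => Real.exp (1 * ∑ j, f (z j)))
      = fun z => ∏ j, Real.exp (f (z j)) := by
    simp only [one_mul, Real.exp_sum]
  have hint : Integrable (fun z : Fin N → E => Real.exp (1 * ∑ j, f (z j)))
      (Measure.pi fun _ => P) := by
    rw [hprod]
    exact Integrable.fintype_prod fun _ => hf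
  refine ENNReal.le_ofReal_iff_toReal_le (measure_ne_top _ _) (Real.exp_pos _).le |>.2 ?_
  calc (Measure.pi fun _ : Fin N => P).real {z | c - N * κ ≤ ∑ j, f (z j)}
      ≤ Real.exp (-1 * (c - N * κ)) * mgf (fun z : Fin N → E => ∑ j, f (z j)) (.pi fun _ => P) 1 :=
        measure_ge_le_exp_mul_mgf _ zero_le_one hint
    _ ≤ Real.exp (-1 * (c - N * κ)) * Real.exp (-κ) ^ N := by
        gcongr
        rw [mgf, hprod, integral_fintype_prod_eq_pow (fun x => Real.exp (f x)), Fintype.card_fin]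
        gcongr
    _ = Real.exp (-c) := by
        rw [← Real.exp_nat_mul, ← Real.exp_add]
        ring_nf

section GramLowerTail

variable {E : Type*} [MeasurableSpace E] {P : Measure E} {d N : ℕ}
  {W : E → EuclideanSpace ℝ (Fin d)} {H L : ℝ}

/-- The points of the lattice `(1 / (2 * √d)) ℤᵈ`, whose cells have diameter `1 / 2`. -/
noncomputable def latticePoint (k : Fin d → ℤ) : EuclideanSpace ℝ (Fin d) :=
  ∑ a, (k a : ℝ) • EuclideanSpace.single a (1 / (2 * √d))

theorem latticePoint_apply (k : Fin d → ℤ) (a : Fin d) :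
    latticePoint k a = k a / (2 * √d) := by
  simp [latticePoint, div_eq_mul_inv, Finset.sum_apply, Pi.single_apply]

theorem norm_latticePoint_sq (k : Fin d → ℤ) :
    ‖latticePoint k‖ ^ 2 = (∑ a, (k a : ℝ) ^ 2) / (4 * d) := by
  rw [EuclideanSpace.real_norm_sq_eq, Finset.sum_div]
  refine Finset.sum_congr rfl fun a _ => ?_
  rw [latticePoint_apply, div_pow, mul_pow, Real.sq_sqrt (Nat.cast_nonneg d)]
  norm_num

theorem sum_smul_single_eq (hd : 0 < d) (v : EuclideanSpace ℝ (Fin d)) :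
    ∑ a, (2 * √d * v a) • EuclideanSpace.single a (1 / (2 * √d)) = v := by
  have : √(d : ℝ) ≠ 0 := by positivity
  ext a
  simp only [WithLp.ofLp_sum, WithLp.ofLp_smul, PiLp.ofLp_single, Finset.sum_apply,
    Pi.smul_apply, smul_eq_mul, Pi.single_apply, mul_ite, mul_zero, Finset.sum_ite_eq,
    Finset.mem_univ, if_true]
  field_simp

theorem norm_latticePoint_sq_le (hd : 0 < d) {k : Fin d → ℤ} {v : EuclideanSpace ℝ (Fin d)}
    (hv : ‖v‖ ≤ 1) (hk : ∀ a, |k a - 2 * √d * v a| ≤ 1) : ‖latticePoint k‖ ^ 2 ≤ 9 / 4 := by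
  have hsq : √(d : ℝ) ^ 2 = d := Real.sq_sqrt (Nat.cast_nonneg d)
  have : 0 < √(d : ℝ) := by positivity
  have hdist : ‖latticePoint k - v‖ ^ 2 ≤ (1 / 2) ^ 2 := by
    calc ‖latticePoint k - v‖ ^ 2 = ∑ a, ((k a - 2 * √d * v a) / (2 * √d)) ^ 2 := by
          rw [EuclideanSpace.real_norm_sq_eq]
          refine Finset.sum_congr rfl fun a _ => ?_
          rw [PiLp.sub_apply, latticePoint_apply]
          field_simp
      _ ≤ ∑ _a : Fin d, 1 / (4 * (d : ℝ)) := by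
          gcongr with a
          rw [div_pow, mul_pow, hsq, ← sq_abs]
          norm_num1
          gcongr
          exact pow_le_one₀ (abs_nonneg _) (hk a)
      _ = (1 / 2) ^ 2 := by
          rw [Finset.sum_const, Finset.card_univ, Fintype.card_fin, nsmul_eq_mul]
          field_simp
          norm_num
  have := abs_le_of_sq_le_sq' hdist (by norm_num)
  have := norm_sub_norm_le (latticePoint k) v
  nlinarith [norm_nonneg (latticePoint k)]

theorem mem_Icc_of_abs_sub_le (hd : 0 < d) {k : ℤ} {x : ℝ} (hx : |x| ≤ 1)
    (hk : |k - 2 * √d * x| ≤ 1) : k ∈ Finset.Icc (-((3 * d : ℕ) : ℤ)) (3 * d : ℕ) := by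
  have hd1 : (1 : ℝ) ≤ d := by exact_mod_cast hd
  have hsqrt : √(d : ℝ) ≤ d := Real.sqrt_le_self_iff.2 (.inr hd1)
  have hkx : |2 * √d * x| ≤ 2 * d := by
    rw [abs_mul, abs_of_nonneg (by positivity)]
    nlinarith [Real.sqrt_nonneg d, abs_nonneg x]
  rw [Finset.mem_Icc, ← abs_le, ← Int.cast_le (R := ℝ)]
  push_cast
  linarith [abs_sub_abs_le_abs_sub (k : ℝ) (2 * √d * x)]

/-- The quadratic form `θ ↦ ∑ j, ⟪w j, θ⟫ ^ 2 - α * ‖θ‖ ^ 2`. -/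
noncomputable def gramQuadraticForm (w : Fin N → EuclideanSpace ℝ (Fin d)) (α : ℝ) :
    QuadraticForm ℝ (EuclideanSpace ℝ (Fin d)) :=
  ∑ j, QuadraticMap.sq.comp (innerₗ _ (w j)) -
    α • LinearMap.BilinMap.toQuadraticMap (innerₗ (EuclideanSpace ℝ (Fin d)))

theorem gramQuadraticForm_apply (w : Fin N → EuclideanSpace ℝ (Fin d)) (α : ℝ)
    (θ : EuclideanSpace ℝ (Fin d)) :
    gramQuadraticForm w α θ = ∑ j, inner ℝ θ (w j) ^ 2 - α * ‖θ‖ ^ 2 := by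
  simp [gramQuadraticForm, real_inner_comm, ← pow_two]

theorem exists_latticePoint_gramQuadraticForm_le (hd : 0 < d)
    (w : Fin N → EuclideanSpace ℝ (Fin d)) {α : ℝ} (hα : 0 ≤ α) {v : EuclideanSpace ℝ (Fin d)}
    (hv : ‖v‖ ≤ 1) :
    ∃ k ∈ Fintype.piFinset fun _ : Fin d => Finset.Icc (-((3 * d : ℕ) : ℤ)) (3 * d : ℕ),
      ‖latticePoint k‖ ^ 2 ≤ 9 / 4 ∧
      gramQuadraticForm w α (latticePoint k)
        ≤ gramQuadraticForm w α v + (∑ j, ‖w j‖ ^ 2) / (16 * d) := by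
  set b : Fin d → EuclideanSpace ℝ (Fin d) := fun a => .single a (1 / (2 * √d))
  have hQ (a : Fin d) : gramQuadraticForm w α (b a) ≤ (∑ j, w j a ^ 2) / (4 * d) := by
    rw [gramQuadraticForm_apply]
    refine (sub_le_self _ (by positivity)).trans_eq ?_
    rw [Finset.sum_div]
    refine Finset.sum_congr rfl fun j _ => ?_
    rw [EuclideanSpace.inner_single_left, mul_pow, conj_trivial, div_pow, mul_pow,
      Real.sq_sqrt (Nat.cast_nonneg d)]
    ring
  obtain ⟨k, hk, hkQ⟩ := exists_int_sum_smul_le (gramQuadraticForm w α) b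
    (fun a => 2 * √d * v a) (fun a => by positivity) hQ Finset.univ 0
  replace hk (a : Fin d) : |k a - 2 * √d * v a| ≤ 1 := hk a (Finset.mem_univ a)
  refine ⟨k, Fintype.mem_piFinset.2 fun a => mem_Icc_of_abs_sub_le hd
    ((PiLp.norm_apply_le v a).trans hv) (hk a), norm_latticePoint_sq_le hd hv hk, ?_⟩
  rw [zero_add, zero_add, sum_smul_single_eq hd] at hkQ
  refine hkQ.trans_eq ?_
  congr 1
  simp only [EuclideanSpace.real_norm_sq_eq]
  rw [← Finset.sum_div, Finset.sum_comm, div_div]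
  ring

theorem le_chernoffRate {s : ℝ} (hs : 0 ≤ s) (hs' : s ≤ 9 / 4) :
    91 / 128 * s - 1 / 15 ≤ chernoffRate s := by
  unfold chernoffRate
  nlinarith

theorem sum_chernoffExponent (w : Fin N → EuclideanSpace ℝ (Fin d)) (H : ℝ)
    (θ : EuclideanSpace ℝ (Fin d)) :
    ∑ j, chernoffExponent H θ (w j)
      = ((∑ j, ‖w j‖ ^ 2) / (16 * d) - ∑ j, inner ℝ θ (w j) ^ 2) / (8 * H) := by
  simp only [chernoffExponent, ← Finset.sum_div, Finset.sum_sub_distrib]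

/-- The threshold of the Chernoff bound at the lattice point `k`: the probability of exceeding it is
at most `exp (-(‖k‖ ^ 2 / 2 + 2 * d + L))`, which sums to at most `exp (-L)`. -/
noncomputable def chernoffThreshold (N : ℕ) (H L : ℝ) (k : Fin d → ℤ) : ℝ :=
  (∑ a, (k a : ℝ) ^ 2) / 2 + 2 * d + L - N * (chernoffRate (‖latticePoint k‖ ^ 2) / (8 * H))

theorem le_sum_inner_sq_of_norm_eq_one (hd : 0 < d) (hH : 0 < H) (hL : 0 ≤ L)
    (hN : 80 * H * (d + 2 * L) ≤ N) {w : Fin N → EuclideanSpace ℝ (Fin d)}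
    (hw : ∀ k ∈ Fintype.piFinset fun _ : Fin d => Finset.Icc (-((3 * d : ℕ) : ℤ)) (3 * d : ℕ),
      ∑ j, chernoffExponent H (latticePoint k) (w j) < chernoffThreshold N H L k)
    {v : EuclideanSpace ℝ (Fin d)} (hv : ‖v‖ = 1) :
    (N : ℝ) / 5 ≤ ∑ j, inner ℝ v (w j) ^ 2 := by
  have hHd : 0 < H * d := by positivity
  have hHL : 0 ≤ H * L := by positivity
  obtain ⟨k, hk_mem, hk_norm, hk⟩ := exists_latticePoint_gramQuadraticForm_le hd w
    (α := 91 / 128 * N - 16 * H * d) (by linarith) hv.le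
  have hk_sum : (∑ a, (k a : ℝ) ^ 2) / 2 = 2 * d * ‖latticePoint k‖ ^ 2 := by
    rw [norm_latticePoint_sq]
    field_simp
    norm_num
  have hrate := mul_le_mul_of_nonneg_left (le_chernoffRate (sq_nonneg _) hk_norm)
    (Nat.cast_nonneg (α := ℝ) N)
  have hkw := hw k hk_mem
  rw [sum_chernoffExponent, chernoffThreshold, hk_sum, div_lt_iff₀ (by positivity), sub_mul,
    ← mul_div_assoc, div_mul_cancel₀ _ (by positivity)] at hkw
  rw [gramQuadraticForm_apply, gramQuadraticForm_apply, hv] at hk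
  linarith

theorem le_sum_inner_sq_of_forall_norm_eq_one {c : ℝ} {w : Fin N → EuclideanSpace ℝ (Fin d)}
    (h : ∀ v : EuclideanSpace ℝ (Fin d), ‖v‖ = 1 → c ≤ ∑ j, inner ℝ v (w j) ^ 2)
    (v : EuclideanSpace ℝ (Fin d)) : c * ‖v‖ ^ 2 ≤ ∑ j, inner ℝ v (w j) ^ 2 := by
  rcases eq_or_ne v 0 with rfl | hv
  · simp
  have : 0 < ‖v‖ := norm_pos_iff.2 hv
  have hunit := h (‖v‖⁻¹ • v) (norm_smul_inv_norm hv)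
  simp only [real_inner_smul_left, mul_pow, ← Finset.mul_sum] at hunit
  rwa [inv_pow, inv_mul_eq_div, le_div_iff₀ (by positivity)] at hunit

theorem IsotropicFourthMoment.measure_chernoffThreshold_le [IsProbabilityMeasure P]
    (h : IsotropicFourthMoment P W H) (hd : 0 < d) (hH : 0 < H) (N : ℕ) (L : ℝ)
    (k : Fin d → ℤ) :
    Measure.pi (fun _ : Fin N => P) {z | chernoffThreshold N H L k
        ≤ ∑ j, chernoffExponent H (latticePoint k) (truncNorm (isotropicTruncLevel d H) (W (z j)))}
      ≤ ENNReal.ofReal (Real.exp (-((∑ a, (k a : ℝ) ^ 2) / 2 + 2 * d + L))) :=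
  measure_pi_le_sum_le_exp_neg (h.integrable_exp_chernoffExponent hd hH _)
    (h.integral_exp_chernoffExponent_le hd hH _) N _

theorem sum_ofReal_exp_neg_le (d B : ℕ) (L : ℝ) :
    ∑ k ∈ Fintype.piFinset fun _ : Fin d => Finset.Icc (-(B : ℤ)) B,
      ENNReal.ofReal (Real.exp (-((∑ a, (k a : ℝ) ^ 2) / 2 + 2 * d + L)))
      ≤ ENNReal.ofReal (Real.exp (-L)) := by
  rw [← ENNReal.ofReal_sum_of_nonneg fun _ _ => (Real.exp_pos _).le]
  gcongr
  calc ∑ k ∈ Fintype.piFinset fun _ : Fin d => Finset.Icc (-(B : ℤ)) B,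
        Real.exp (-((∑ a, (k a : ℝ) ^ 2) / 2 + 2 * d + L))
      = (∑ k ∈ Fintype.piFinset fun _ : Fin d => Finset.Icc (-(B : ℤ)) B,
        Real.exp (-((∑ a, (k a : ℝ) ^ 2) / 2))) * Real.exp (-(2 * d + L)) := by
        rw [Finset.sum_mul]
        refine Finset.sum_congr rfl fun k _ => ?_
        rw [← Real.exp_add]
        ring_nf
    _ ≤ Real.exp (2 * d) * Real.exp (-(2 * d + L)) := by
        gcongr
        exact sum_piFinset_Icc_exp_neg_sum_sq_div_two_le d B
    _ = Real.exp (-L) := by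
        rw [← Real.exp_add]
        ring_nf

theorem IsotropicFourthMoment.measure_sum_inner_sq_lt_le [IsProbabilityMeasure P]
    (h : IsotropicFourthMoment P W H) (hd : 0 < d) (hH : 0 < H) (hL : 0 ≤ L)
    (hN : 80 * H * (d + 2 * L) ≤ N) :
    Measure.pi (fun _ : Fin N => P) {z | ¬∀ v : EuclideanSpace ℝ (Fin d),
        N / 5 * ‖v‖ ^ 2 ≤ ∑ j, inner ℝ v (W (z j)) ^ 2}
      ≤ ENNReal.ofReal (Real.exp (-L)) := by
  refine le_trans (measure_mono fun z hz => ?_) <|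
    (measure_biUnion_finset_le (Fintype.piFinset fun _ : Fin d =>
      Finset.Icc (-((3 * d : ℕ) : ℤ)) (3 * d : ℕ)) fun k => _).trans <|
    (Finset.sum_le_sum fun k _ => h.measure_chernoffThreshold_le hd hH N L k).trans <|
    sum_ofReal_exp_neg_le d (3 * d) L
  by_contra hgood
  simp only [Set.mem_iUnion, Set.mem_ofPred_eq, not_exists, not_le] at hgood
  refine hz fun v => (le_sum_inner_sq_of_forall_norm_eq_one
    (fun u hu => le_sum_inner_sq_of_norm_eq_one hd hH hL hN hgood hu) v).trans ?_
  exact Finset.sum_le_sum fun j _ => inner_truncNorm_sq_le _ v (W (z j))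

end GramLowerTail

section NormalEquations

variable {F κ : Type*} [NormedAddCommGroup F] [InnerProductSpace ℝ F] [Fintype κ] {c : ℝ}

theorem mul_norm_le_norm_apply {A : F →L[ℝ] F} (hA : ∀ v, c * ‖v‖ ^ 2 ≤ inner ℝ v (A v)) (v : F) :
    c * ‖v‖ ≤ ‖A v‖ := by
  rcases (norm_nonneg v).eq_or_lt with h0 | h0
  · simp [← h0]
  · refine le_of_mul_le_mul_left ?_ h0
    calc ‖v‖ * (c * ‖v‖) = c * ‖v‖ ^ 2 := by ring
      _ ≤ inner ℝ v (A v) := hA v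
      _ ≤ ‖v‖ * ‖A v‖ := real_inner_le_norm v (A v)

theorem isUnit_of_mul_norm_sq_le_inner [FiniteDimensional ℝ F] {A : F →L[ℝ] F} (hc : 0 < c)
    (hA : ∀ v, c * ‖v‖ ^ 2 ≤ inner ℝ v (A v)) : IsUnit A := by
  have hinj : Function.Injective A := (injective_iff_map_eq_zero A).2 fun v hv => by
    have h := mul_norm_le_norm_apply hA v
    rw [hv, norm_zero] at h
    exact norm_le_zero_iff.1 (nonpos_of_mul_nonpos_right h hc)
  rw [ContinuousLinearMap.isUnit_iff_bijective]
  exact ⟨hinj, LinearMap.injective_iff_surjective.1 hinj⟩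

theorem apply_inverse_apply {A : F →L[ℝ] F} (hA : IsUnit A) (v : F) : A (Ring.inverse A v) = v :=
  DFunLike.congr_fun (Ring.mul_inverse_cancel A hA) v

theorem inverse_apply_apply {A : F →L[ℝ] F} (hA : IsUnit A) (v : F) : Ring.inverse A (A v) = v :=
  DFunLike.congr_fun (Ring.inverse_mul_cancel A hA) v

/-- The Gram operator `∑ⱼ wⱼ wⱼᵀ` of a finite family of vectors. -/
noncomputable def gramOperator (w : κ → F) : F →L[ℝ] F :=
  ∑ j, (innerSL ℝ (w j)).smulRight (w j)

/-- The solution `(∑ⱼ wⱼ wⱼᵀ)⁻¹ ∑ⱼ eⱼ wⱼ` of the normal equations for the regression of `e` on `w`;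
it is `0` where the Gram operator is not invertible. -/
noncomputable def normalSolution (w : κ → F) (e : κ → ℝ) : F :=
  Ring.inverse (gramOperator w) (∑ j, e j • w j)

theorem gramOperator_apply (w : κ → F) (v : F) : gramOperator w v = ∑ j, inner ℝ (w j) v • w j := by
  simp [gramOperator]

theorem inner_gramOperator_apply_self (w : κ → F) (v : F) :
    inner ℝ v (gramOperator w v) = ∑ j, inner ℝ v (w j) ^ 2 := by
  rw [gramOperator_apply, inner_sum]
  refine Finset.sum_congr rfl fun j _ => ?_
  rw [real_inner_smul_right, real_inner_comm, sq]

theorem continuous_gramOperator : Continuous (gramOperator : (κ → F) → F →L[ℝ] F) := by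
  unfold gramOperator
  exact continuous_finsetSum _ fun j _ => by fun_prop

theorem norm_normalSolution_le [FiniteDimensional ℝ F] (hc : 0 < c) {w : κ → F}
    (hw : ∀ v, c * ‖v‖ ^ 2 ≤ ∑ j, inner ℝ v (w j) ^ 2) (e : κ → ℝ) :
    ‖normalSolution w e‖ ≤ c⁻¹ * ‖∑ j, e j • w j‖ := by
  simp_rw [← inner_gramOperator_apply_self] at hw
  rw [le_inv_mul_iff₀ hc]
  refine (mul_norm_le_norm_apply hw _).trans_eq ?_
  rw [normalSolution, apply_inverse_apply (isUnit_of_mul_norm_sq_le_inner hc hw)]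

theorem measurable_normalSolution_fst_snd [FiniteDimensional ℝ F] [MeasurableSpace F]
    [BorelSpace F] :
    Measurable fun y : κ → F × ℝ => normalSolution (fun j => (y j).1) (fun j => (y j).2) := by
  classical
  set A : (κ → F × ℝ) → F →L[ℝ] F := fun y => gramOperator fun j => (y j).1
  have hcont : Continuous A := continuous_gramOperator.comp (by fun_prop)
  have hopen : IsOpen {y | IsUnit (A y)} := Units.isOpen.preimage hcont
  have hpiece : (fun y : κ → F × ℝ => normalSolution (fun j => (y j).1) (fun j => (y j).2)) =
      {y | IsUnit (A y)}.indicator fun y => Ring.inverse (A y) (∑ j, (y j).2 • (y j).1) := by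
    refine (Set.indicator_eq_self.2 fun y hy => ?_).symm
    contrapose! hy
    exact Function.notMem_support.2 (DFunLike.congr_fun (Ring.inverse_non_unit (A y) hy) _)
  rw [hpiece, ← Set.piecewise_eq_indicator]
  refine ContinuousOn.measurable_piecewise (fun y hy => ?_) continuousOn_const hopen.measurableSet
  obtain ⟨u, hu⟩ : IsUnit (A y) := hy
  have hinv : ContinuousAt (fun y => Ring.inverse (A y)) y :=
    ContinuousAt.comp (g := Ring.inverse) (hu ▸ NormedRing.inverse_continuousAt u)
      hcont.continuousAt
  exact (hinv.clm_apply (by fun_prop)).continuousWithinAt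

theorem measurable_normalSolution {α : Type*} [MeasurableSpace α] [FiniteDimensional ℝ F]
    [MeasurableSpace F] [BorelSpace F] {w : α → κ → F} {e : α → κ → ℝ}
    (hw : ∀ j, Measurable fun a => w a j) (he : ∀ j, Measurable fun a => e a j) :
    Measurable fun a => normalSolution (w a) (e a) := by
  have hwe : Measurable fun a j => (w a j, e a j) :=
    measurable_pi_lambda _ fun j => (hw j).prodMk (he j)
  have hcomp := measurable_normalSolution_fst_snd.comp hwe
  exact hcomp

end NormalEquations

section LeaveOneOut

variable {F : Type*} [NormedAddCommGroup F] [InnerProductSpace ℝ F] {N : ℕ} {w : Fin (N + 1) → F}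
  {e : Fin (N + 1) → ℝ} {θ : F} {c : ℝ}

theorem gramOperator_removeNth_apply (hnormal : ∑ j, (e j - inner ℝ (w j) θ) • w j = 0)
    (i : Fin (N + 1)) :
    gramOperator (i.removeNth w) θ =
      ∑ j, i.removeNth e j • i.removeNth w j + (e i - inner ℝ (w i) θ) • w i := by
  rw [Fin.sum_univ_succAbove _ i] at hnormal
  rw [gramOperator_apply, ← sub_eq_zero, ← neg_eq_zero, ← hnormal]
  simp only [sub_smul, Finset.sum_sub_distrib, Fin.removeNth]
  abel

theorem abs_le_abs_add_mul_abs_of_eq_add_mul {t a b ℓ : ℝ} (hℓ : 0 ≤ ℓ)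
    (h : t = a + (b - t) * ℓ) : |t| ≤ |a| + ℓ * |b| := by
  have h1 : t * (1 + ℓ) = a + ℓ * b := by linarith
  calc |t| ≤ |t| * (1 + ℓ) := le_mul_of_one_le_right (abs_nonneg t) (by linarith)
    _ = |a + ℓ * b| := by rw [← h1, abs_mul, abs_of_nonneg (by linarith : 0 ≤ 1 + ℓ)]
    _ ≤ |a| + ℓ * |b| := (abs_add_le a _).trans_eq (by rw [abs_mul, abs_of_nonneg hℓ])

/-- Solving the normal equations with the `i`-th observation moved to the right-hand side, `⟪wᵢ, θ⟫`
is a contraction of `⟪wᵢ, g⟫ + ℓ eᵢ` for the leave-one-out solution `g` and the leverage `ℓ`. -/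
theorem abs_inner_le_of_normal_equations [FiniteDimensional ℝ F] (hc : 0 < c)
    (hnormal : ∑ j, (e j - inner ℝ (w j) θ) • w j = 0) (i : Fin (N + 1))
    (hw : ∀ v, c * ‖v‖ ^ 2 ≤ ∑ j, inner ℝ v (i.removeNth w j) ^ 2) :
    |inner ℝ (w i) θ| ≤ |inner ℝ (normalSolution (i.removeNth w) (i.removeNth e)) (w i)|
      + c⁻¹ * ‖‖w i‖ ^ 2 * e i‖ := by
  simp_rw [← inner_gramOperator_apply_self] at hw
  set A := gramOperator (i.removeNth w)
  have hA : IsUnit A := isUnit_of_mul_norm_sq_le_inner hc hw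
  set u := Ring.inverse A (w i)
  have hAu : A u = w i := apply_inverse_apply hA _
  have hθ : θ = normalSolution (i.removeNth w) (i.removeNth e) + (e i - inner ℝ (w i) θ) • u := by
    rw [normalSolution, ← map_smul, ← map_add, ← gramOperator_removeNth_apply hnormal,
      inverse_apply_apply hA]
  have hleverage_nonneg : 0 ≤ inner ℝ (w i) u := by
    rw [← hAu, real_inner_comm]
    exact (by positivity : (0 : ℝ) ≤ c * ‖u‖ ^ 2).trans (hw u)
  have hleverage_le : inner ℝ (w i) u ≤ c⁻¹ * ‖w i‖ ^ 2 := by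
    have hu : ‖u‖ ≤ c⁻¹ * ‖w i‖ := by
      rw [le_inv_mul_iff₀ hc, ← hAu]
      exact mul_norm_le_norm_apply hw u
    calc inner ℝ (w i) u ≤ ‖w i‖ * ‖u‖ := real_inner_le_norm _ _
      _ ≤ ‖w i‖ * (c⁻¹ * ‖w i‖) := by gcongr
      _ = c⁻¹ * ‖w i‖ ^ 2 := by ring
  refine (abs_le_abs_add_mul_abs_of_eq_add_mul hleverage_nonneg (b := e i)
    (a := inner ℝ (normalSolution (i.removeNth w) (i.removeNth e)) (w i)) ?_).trans ?_
  · conv_lhs => rw [hθ]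
    rw [inner_add_right, real_inner_smul_right, real_inner_comm]
  · refine add_le_add_right ?_ _
    calc inner ℝ (w i) u * |e i| ≤ c⁻¹ * ‖w i‖ ^ 2 * |e i| := by gcongr
      _ = c⁻¹ * ‖‖w i‖ ^ 2 * e i‖ := by simp [mul_assoc]

end LeaveOneOut

section Moments

variable {E F : Type*} [MeasurableSpace E] [NormedAddCommGroup F] {P : Measure E} {Z : E → F}
  {p q r s A B T : ℝ}

theorem eLpNorm_smul_le_ofReal_mul [NormedSpace ℝ F] {f : E → ℝ} (hp : 0 < p) (hq : 0 < q)
    (hr : 0 < r) (hpqr : 1 / p + 1 / q = 1 / r) (hA : 0 ≤ A) (hf : AEStronglyMeasurable f P)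
    (hZ : AEStronglyMeasurable Z P) (hfA : eLpNorm f (.ofReal p) P ≤ .ofReal A)
    (hZB : eLpNorm Z (.ofReal q) P ≤ .ofReal B) :
    eLpNorm (fun x => f x • Z x) (.ofReal r) P ≤ .ofReal (A * B) := by
  have : ENNReal.HolderTriple (.ofReal p) (.ofReal q) (.ofReal r) := ⟨by
    rw [← ENNReal.ofReal_inv_of_pos hp, ← ENNReal.ofReal_inv_of_pos hq,
      ← ENNReal.ofReal_inv_of_pos hr, ← ENNReal.ofReal_add (by positivity) (by positivity)]
    simpa only [one_div] using congrArg ENNReal.ofReal hpqr⟩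
  rw [ENNReal.ofReal_mul hA]
  exact (eLpNorm_smul_le_mul_eLpNorm hZ hf).trans (mul_le_mul' hfA hZB)

theorem measure_lt_norm_le_of_eLpNorm_le (hp : 0 < p) (hA : 0 ≤ A) (hT : 0 < T)
    (hZ : AEStronglyMeasurable Z P) (hZA : eLpNorm Z (.ofReal p) P ≤ .ofReal A) :
    P {x | T < ‖Z x‖} ≤ .ofReal ((A / T) ^ p) := by
  have hsub : {x | T < ‖Z x‖} ⊆ {x | ENNReal.ofReal T ≤ ‖Z x‖ₑ} := fun x hx => by
    rw [Set.mem_ofPred_eq, ← ofReal_norm]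
    exact ENNReal.ofReal_le_ofReal (le_of_lt hx)
  calc P {x | T < ‖Z x‖} ≤ P {x | ENNReal.ofReal T ≤ ‖Z x‖ₑ} := measure_mono hsub
    _ ≤ (ENNReal.ofReal T)⁻¹ ^ p * eLpNorm Z (.ofReal p) P ^ p := by
      have h := meas_ge_le_mul_pow_eLpNorm_enorm P (ENNReal.ofReal_ne_zero_iff.2 hp)
        ENNReal.ofReal_ne_top hZ (ENNReal.ofReal_ne_zero_iff.2 hT)
        fun h => absurd h ENNReal.ofReal_ne_top
      rwa [ENNReal.toReal_ofReal hp.le] at h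
    _ ≤ (ENNReal.ofReal T)⁻¹ ^ p * ENNReal.ofReal A ^ p := by gcongr
    _ = .ofReal ((A / T) ^ p) := by
      rw [← ENNReal.mul_rpow_of_nonneg _ _ hp.le, ← ENNReal.ofReal_inv_of_pos hT,
        ← ENNReal.ofReal_mul (by positivity), ENNReal.ofReal_rpow_of_nonneg (by positivity) hp.le,
        inv_mul_eq_div]

theorem eLpNorm_sq_eq_eLpNorm_norm_sq (Z : E → F) (p : ENNReal) :
    eLpNorm Z p P ^ 2 = eLpNorm (fun x => ‖Z x‖ ^ 2) (p / 2) P := by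
  have h := eLpNorm_norm_rpow (μ := P) (p := p / 2) Z (q := 2) two_pos
  simp only [ENNReal.ofReal_ofNat, ENNReal.rpow_ofNat, Real.rpow_ofNat] at h
  rw [h, ENNReal.div_mul_cancel (by simp) (by simp)]

theorem eLpNorm_sq_le_sum_eLpNorm_apply_sq {ι : Type*} [Fintype ι] {W : E → EuclideanSpace ℝ ι}
    {p : ENNReal} (hp : 2 ≤ p) (hW : AEStronglyMeasurable W P) :
    eLpNorm W p P ^ 2 ≤ ∑ a, eLpNorm (fun x => W x a) p P ^ 2 := by
  have hp2 : 1 ≤ p / 2 := by rwa [ENNReal.le_div_iff_mul_le (by simp) (by simp), one_mul]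
  have hcoord : ∀ a, AEStronglyMeasurable (fun x => W x a) P := fun a =>
    (EuclideanSpace.proj a).continuous.comp_aestronglyMeasurable hW
  calc eLpNorm W p P ^ 2 = eLpNorm (∑ a, fun x => ‖W x a‖ ^ 2) (p / 2) P := by
        rw [eLpNorm_sq_eq_eLpNorm_norm_sq]
        congr 1
        ext x
        rw [EuclideanSpace.norm_sq_eq, Finset.sum_apply]
    _ ≤ ∑ a, eLpNorm (fun x => ‖W x a‖ ^ 2) (p / 2) P :=
        eLpNorm_sum_le (fun a _ => (hcoord a).norm.pow 2) hp2
    _ = ∑ a, eLpNorm (fun x => W x a) p P ^ 2 := by simp_rw [eLpNorm_sq_eq_eLpNorm_norm_sq]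

theorem eLpNorm_le_ofReal_sqrt_card_mul {ι : Type*} [Fintype ι] {W : E → EuclideanSpace ℝ ι}
    {p : ENNReal} (hp : 2 ≤ p) (hW : AEStronglyMeasurable W P)
    (h : ∀ a, eLpNorm (fun x => W x a) p P ≤ .ofReal A) :
    eLpNorm W p P ≤ .ofReal (√(Fintype.card ι) * A) := by
  rw [← ENNReal.pow_le_pow_left_iff two_ne_zero]
  calc eLpNorm W p P ^ 2 ≤ ∑ a, eLpNorm (fun x => W x a) p P ^ 2 :=
        eLpNorm_sq_le_sum_eLpNorm_apply_sq hp hW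
    _ ≤ ∑ _a : ι, ENNReal.ofReal A ^ 2 := by gcongr with a; exact h a
    _ = ENNReal.ofReal (√(Fintype.card ι) * A) ^ 2 := by
      rw [Finset.sum_const, Finset.card_univ, nsmul_eq_mul, ENNReal.ofReal_mul (by positivity),
        mul_pow, ← ENNReal.ofReal_pow (Real.sqrt_nonneg _), Real.sq_sqrt (by positivity),
        ENNReal.ofReal_natCast]

theorem measure_prod_lt_abs_inner_le {G : Type*} [InnerProductSpace ℝ F] [SecondCountableTopology F]
    [MeasurableSpace F] [BorelSpace F] [MeasurableSpace G] [IsProbabilityMeasure P]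
    {π : Measure G} [IsProbabilityMeasure π] {W : E → F} (hW : Measurable W) {θ : G → F}
    (hθ : Measurable θ) {h : G → ℝ} (hh : Measurable h) (hp : 0 < p) (hA : 0 ≤ A) (hT : 0 < T)
    (hWA : ∀ u, eLpNorm (fun x => inner ℝ u (W x)) (.ofReal p) P ≤ .ofReal (A * ‖u‖)) :
    (P.prod π) {y | ‖θ y.2‖ ≤ h y.2 ∧ T < |inner ℝ (θ y.2) (W y.1)|}
      ≤ ∫⁻ y, .ofReal ((A * h y / T) ^ p) ∂π := by
  have hs : MeasurableSet {y : E × G | ‖θ y.2‖ ≤ h y.2 ∧ T < |inner ℝ (θ y.2) (W y.1)|} := by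
    rw [Set.ofPred_and]
    exact (measurableSet_le (by fun_prop) (by fun_prop)).inter
      (measurableSet_lt measurable_const (by fun_prop))
  rw [Measure.prod_apply_symm hs]
  refine lintegral_mono fun y => ?_
  by_cases hy : ‖θ y‖ ≤ h y
  · have hh0 : 0 ≤ h y := (norm_nonneg _).trans hy
    refine (measure_mono fun x hx => hx.2).trans <|
      measure_lt_norm_le_of_eLpNorm_le hp (by positivity) hT (by fun_prop) ((hWA (θ y)).trans ?_)
    gcongr
  · simp [hy]

end Moments

theorem one_div_harm (qx q m k : ℝ) : 1 / harm qx q m k = m * (1 / qx) + k * (1 / q) := by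
  rw [harm, one_div, inv_inv, mul_one_div, mul_one_div]

/-- A regression model with isotropic covariate `W` and error `e` uncorrelated with it, with the
moment bounds of the theorem: it is satisfied by `W = Σ^{-1/2} X` and `e = Y - Xᵀβ`. -/
structure WhitenedModel {E : Type*} [MeasurableSpace E] {d : ℕ} (P : Measure E)
    (W : E → EuclideanSpace ℝ (Fin d)) (e : E → ℝ) (qx q Kx Ky : ℝ) : Prop where
  measurable_covariate : Measurable W
  measurable_error : Measurable e
  integral_inner_sq : ∀ u, ∫ x, inner ℝ u (W x) ^ 2 ∂P = ‖u‖ ^ 2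
  integral_smul_eq_zero : ∫ x, e x • W x ∂P = 0
  eLpNorm_inner_le : ∀ u, eLpNorm (fun x => inner ℝ u (W x)) (.ofReal qx) P ≤ .ofReal (Kx * ‖u‖)
  eLpNorm_error_le : eLpNorm e (.ofReal q) P ≤ .ofReal Ky

namespace WhitenedModel

variable {E : Type*} [MeasurableSpace E] {d : ℕ} {P : Measure E} {W : E → EuclideanSpace ℝ (Fin d)}
  {e : E → ℝ} {qx q Kx Ky : ℝ}

theorem eLpNorm_covariate_le (h : WhitenedModel P W e qx q Kx Ky) (hqx : 2 ≤ qx) :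
    eLpNorm W (.ofReal qx) P ≤ .ofReal (√d * Kx) := by
  have hle := eLpNorm_le_ofReal_sqrt_card_mul
    (ENNReal.ofReal_ofNat 2 ▸ ENNReal.ofReal_le_ofReal hqx)
    h.measurable_covariate.aestronglyMeasurable (A := Kx) (P := P) (fun a => by
      simpa [EuclideanSpace.inner_single_left] using h.eLpNorm_inner_le (EuclideanSpace.single a 1))
  rwa [Fintype.card_fin] at hle

theorem eLpNorm_score_le (h : WhitenedModel P W e qx q Kx Ky) (hqx : 2 ≤ qx) (hq : 0 < q)
    (hKy : 0 ≤ Ky) :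
    eLpNorm (fun x => e x • W x) (.ofReal (harm qx q 1 1)) P ≤ .ofReal (√d * Kx * Ky) := by
  rw [mul_comm _ Ky]
  refine eLpNorm_smul_le_ofReal_mul hq (by linarith) (by unfold harm; positivity) ?_ hKy
    h.measurable_error.aestronglyMeasurable h.measurable_covariate.aestronglyMeasurable
    h.eLpNorm_error_le (h.eLpNorm_covariate_le hqx)
  rw [one_div_harm, one_mul, one_mul, add_comm]

theorem eLpNorm_leverage_le (h : WhitenedModel P W e qx q Kx Ky) (hqx : 2 ≤ qx) (hq : 0 < q)
    (hKx : 0 ≤ Kx) (hKy : 0 ≤ Ky) :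
    eLpNorm (fun x => ‖W x‖ ^ 2 * e x) (.ofReal (harm qx q 2 1)) P ≤ .ofReal (d * Kx ^ 2 * Ky) := by
  have hW := h.measurable_covariate
  have he := h.measurable_error
  have hnorm : ∀ x, ‖‖W x‖ ^ 2 * e x‖ = ‖‖W x‖ • e x • W x‖ := fun x => by
    simp only [norm_smul, norm_mul, norm_pow, norm_norm]
    ring
  have hconst : (d : ℝ) * Kx ^ 2 * Ky = √d * Kx * (√d * Kx * Ky) := by
    linear_combination -(Kx ^ 2 * Ky) * Real.mul_self_sqrt (Nat.cast_nonneg (α := ℝ) d)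
  rw [eLpNorm_congr_norm_ae (ae_of_all P hnorm), hconst]
  refine eLpNorm_smul_le_ofReal_mul (p := qx) (q := harm qx q 1 1) (by linarith)
    (by unfold harm; positivity) (by unfold harm; positivity) ?_ (by positivity)
    hW.norm.aestronglyMeasurable (he.smul hW).aestronglyMeasurable ?_
      (h.eLpNorm_score_le hqx hq hKy)
  · rw [one_div_harm, one_div_harm]
    ring
  · rw [eLpNorm_norm]
    exact h.eLpNorm_covariate_le hqx

theorem isotropicFourthMoment [IsProbabilityMeasure P] (h : WhitenedModel P W e qx q Kx Ky)
    (hqx : 4 ≤ qx) (hKx : 0 ≤ Kx) : IsotropicFourthMoment P W (Kx ^ 4) where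
  integral_inner_sq := h.integral_inner_sq
  memLp := by
    have hmem : MemLp W (.ofReal qx) P := ⟨h.measurable_covariate.aestronglyMeasurable,
      (h.eLpNorm_covariate_le (by linarith)).trans_lt ENNReal.ofReal_lt_top⟩
    exact hmem.mono_exponent (ENNReal.ofReal_ofNat 4 ▸ ENNReal.ofReal_le_ofReal hqx)
  integral_inner_pow_four_le u := by
    have hm : AEStronglyMeasurable (fun x => inner ℝ u (W x)) P :=
      (measurable_const.inner h.measurable_covariate).aestronglyMeasurable
    have h4 := integral_norm_rpow_le_of_eLpNorm_le (p := 4) (A := Kx * ‖u‖) (by norm_num)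
      (by positivity) hm
      ((eLpNorm_le_eLpNorm_of_exponent_le (ENNReal.ofReal_le_ofReal hqx) hm).trans
        (h.eLpNorm_inner_le u))
    simpa only [Real.rpow_ofNat, Real.norm_eq_abs, Even.pow_abs (show Even 4 by decide), mul_pow]
      using h4

end WhitenedModel

section OptimalityConditions

theorem integral_mul_eq_zero_of_forall_integral_sq_le {G : Type*} [MeasurableSpace G]
    {μ : Measure G} {f g : G → ℝ} (hf : MemLp f 2 μ) (hg : MemLp g 2 μ)
    (h : ∀ t : ℝ, ∫ x, f x ^ 2 ∂μ ≤ ∫ x, (f x - t * g x) ^ 2 ∂μ) : ∫ x, g x * f x ∂μ = 0 := by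
  have hexpand : ∀ t : ℝ, ∫ x, (f x - t * g x) ^ 2 ∂μ =
      ∫ x, f x ^ 2 ∂μ - 2 * t * ∫ x, g x * f x ∂μ + t ^ 2 * ∫ x, g x ^ 2 ∂μ := fun t => by
    have hcross : Integrable (fun x => 2 * t * (g x * f x)) μ := (hg.integrable_mul hf).const_mul _
    rw [← integral_const_mul, ← integral_const_mul, ← integral_sub hf.integrable_sq hcross,
      ← integral_add (by exact hf.integrable_sq.sub hcross) (hg.integrable_sq.const_mul _)]
    exact integral_congr_ae (ae_of_all _ fun x => by ring)
  have hdiscrim := discrim_le_zero (a := ∫ x, g x ^ 2 ∂μ) (b := -2 * ∫ x, g x * f x ∂μ) (c := 0)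
    fun t => by linarith [h t, hexpand t]
  rw [discrim] at hdiscrim
  nlinarith

theorem IsLeastSquares.sum_smul_eq_zero {n d : ℕ} {x : Fin n → Fin d → ℝ} {y : Fin n → ℝ}
    {b : Fin d → ℝ} (h : IsLeastSquares x y b) : ∑ j, (y j - b ⬝ᵥ x j) • x j = 0 := by
  ext a
  rcases n.eq_zero_or_pos with rfl | hn
  · simp
  have hsum := integral_mul_eq_zero_of_forall_integral_sq_le (μ := Measure.count)
    (f := fun j => y j - b ⬝ᵥ x j) (g := fun j => x j a) .of_discrete .of_discrete fun t => by
      have ht := le_of_mul_le_mul_left (h (b + t • Pi.single a 1)) (by positivity)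
      simpa [integral_count, add_dotProduct, sub_sub] using ht
  simpa [integral_count, mul_comm] using hsum

end OptimalityConditions

section Whitening

variable {d : ℕ} {P : Measure ((Fin d → ℝ) × ℝ)} {β : Fin d → ℝ} {qx q Kx Ky : ℝ}

/-- The whitened covariate `Σ^{-1/2} X`, as a vector of the Euclidean space. -/
noncomputable def whitened (P : Measure ((Fin d → ℝ) × ℝ)) (z : (Fin d → ℝ) × ℝ) :
    EuclideanSpace ℝ (Fin d) :=
  WithLp.toLp 2 (invSqrtGram P *ᵥ z.1)

/-- The regression error `Y - Xᵀβ`. -/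
def residual (β : Fin d → ℝ) (z : (Fin d → ℝ) × ℝ) : ℝ :=
  z.2 - z.1 ⬝ᵥ β

theorem measurable_whitened : Measurable (whitened P) := by
  have : Continuous (whitened P) := by unfold whitened; fun_prop
  exact this.measurable

theorem measurable_residual : Measurable (residual β) := by
  have : Continuous (residual β) := by unfold residual; fun_prop
  exact this.measurable

theorem transpose_sqrt_gram : (CFC.sqrt (gram P))ᵀ = CFC.sqrt (gram P) := by
  have h := (Matrix.nonneg_iff_posSemidef.1 (CFC.sqrt_nonneg (gram P))).1
  rwa [Matrix.IsHermitian, Matrix.conjTranspose_eq_transpose_of_trivial] at h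

theorem inner_whitened (u : EuclideanSpace ℝ (Fin d)) (z : (Fin d → ℝ) × ℝ) :
    inner ℝ u (whitened P z) = (invSqrtGram P *ᵥ u.ofLp) ⬝ᵥ z.1 := by
  have hsymm : (invSqrtGram P)ᵀ = invSqrtGram P := by
    rw [invSqrtGram, Matrix.transpose_nonsing_inv, transpose_sqrt_gram]
  rw [whitened, EuclideanSpace.inner_eq_star_dotProduct, star_trivial, dotProduct_comm,
    Matrix.dotProduct_mulVec, ← Matrix.mulVec_transpose, hsymm]

namespace IsRegressionLaw

theorem memLp_dotProduct (h : IsRegressionLaw P) (v : Fin d → ℝ) :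
    MemLp (fun z : (Fin d → ℝ) × ℝ => v ⬝ᵥ z.1) 2 P :=
  memLp_finsetSum Finset.univ fun a _ => (h.memLp_covariate a).const_mul (v a)

theorem memLp_residual (h : IsRegressionLaw P) (β : Fin d → ℝ) : MemLp (residual β) 2 P := by
  simp only [funext fun z => (by rw [residual, dotProduct_comm] : residual β z = z.2 - β ⬝ᵥ z.1)]
  exact h.memLp_response.sub (h.memLp_dotProduct β)

theorem dotProduct_gram_mulVec (h : IsRegressionLaw P) (v : Fin d → ℝ) :
    v ⬝ᵥ (gram P *ᵥ v) = ∫ z, (v ⬝ᵥ z.1) ^ 2 ∂P := by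
  have hint : ∀ a b, Integrable (fun z : (Fin d → ℝ) × ℝ => v a * z.1 a * (v b * z.1 b)) P :=
    fun a b => ((h.memLp_covariate a).const_mul _).integrable_mul
      ((h.memLp_covariate b).const_mul _)
  simp only [sq, dotProduct, Finset.sum_mul_sum]
  rw [integral_finsetSum _ fun a _ => integrable_finsetSum _ fun b _ => hint a b]
  refine Finset.sum_congr rfl fun a _ => ?_
  rw [integral_finsetSum _ fun b _ => hint a b, Matrix.mulVec, dotProduct, Finset.mul_sum]
  refine Finset.sum_congr rfl fun b _ => ?_
  rw [gram, Matrix.of_apply, ← integral_mul_const, ← integral_const_mul]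
  exact integral_congr_ae (ae_of_all _ fun z => by ring)

theorem sqrt_gram_mul_self (h : IsRegressionLaw P) :
    CFC.sqrt (gram P) * CFC.sqrt (gram P) = gram P := by
  have hpos : (gram P).PosSemidef := by
    refine Matrix.PosSemidef.of_dotProduct_mulVec_nonneg ?_ fun v => ?_
    · ext a b
      simp [gram, mul_comm]
    · rw [star_trivial, h.dotProduct_gram_mulVec]
      exact integral_nonneg fun _ => sq_nonneg _
  exact CFC.sqrt_mul_sqrt_self _ (Matrix.nonneg_iff_posSemidef.2 hpos)

theorem sqrt_gram_mulVec_invSqrtGram_mulVec (h : IsRegressionLaw P) (v : Fin d → ℝ) :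
    CFC.sqrt (gram P) *ᵥ (invSqrtGram P *ᵥ v) = v := by
  have hunit : IsUnit (CFC.sqrt (gram P)).det := by
    have hgram := (Matrix.isUnit_iff_isUnit_det _).1 h.isUnit_gram
    rw [← h.sqrt_gram_mul_self, Matrix.det_mul] at hgram
    exact isUnit_of_mul_isUnit_left hgram
  rw [invSqrtGram, Matrix.mulVec_mulVec, Matrix.mul_nonsing_inv _ hunit, Matrix.one_mulVec]

theorem inner_whitened_toLp_sqrt_gram (h : IsRegressionLaw P) (z : (Fin d → ℝ) × ℝ)
    (v : Fin d → ℝ) :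
    inner ℝ (whitened P z) (WithLp.toLp 2 (CFC.sqrt (gram P) *ᵥ v)) = z.1 ⬝ᵥ v := by
  rw [whitened, EuclideanSpace.inner_toLp_toLp, star_trivial, dotProduct_comm,
    Matrix.dotProduct_mulVec, ← Matrix.mulVec_transpose, transpose_sqrt_gram,
    h.sqrt_gram_mulVec_invSqrtGram_mulVec]

theorem integral_inner_whitened_sq (h : IsRegressionLaw P) (u : EuclideanSpace ℝ (Fin d)) :
    ∫ z, inner ℝ u (whitened P z) ^ 2 ∂P = ‖u‖ ^ 2 := by
  simp_rw [inner_whitened]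
  rw [← h.dotProduct_gram_mulVec, ← h.sqrt_gram_mul_self, ← Matrix.mulVec_mulVec,
    h.sqrt_gram_mulVec_invSqrtGram_mulVec, Matrix.dotProduct_mulVec, ← Matrix.mulVec_transpose,
    transpose_sqrt_gram, h.sqrt_gram_mulVec_invSqrtGram_mulVec, ← real_inner_self_eq_norm_sq,
    EuclideanSpace.inner_eq_star_dotProduct, star_trivial]

end IsRegressionLaw

theorem IsProjectionParameter.integral_dotProduct_mul_residual_eq_zero
    (hβ : IsProjectionParameter P β) (h : IsRegressionLaw P) (v : Fin d → ℝ) :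
    ∫ z, (v ⬝ᵥ z.1) * residual β z ∂P = 0 := by
  refine integral_mul_eq_zero_of_forall_integral_sq_le (h.memLp_residual β) (h.memLp_dotProduct v)
    fun t => ?_
  have ht := hβ (β + t • v)
  simpa only [residual, add_dotProduct, smul_dotProduct, smul_eq_mul, sub_sub,
    dotProduct_comm _ β] using ht

theorem IsProjectionParameter.integral_residual_smul_whitened_eq_zero
    (hβ : IsProjectionParameter P β) (h : IsRegressionLaw P) :
    ∫ z, residual β z • whitened P z ∂P = 0 := by
  have hW : MemLp (whitened P) 2 P :=
    MemLp.of_eval_piLp fun a => h.memLp_dotProduct (invSqrtGram P a)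
  refine integral_eq_zero_of_forall_integral_inner_eq_zero ℝ _ ?_ fun u => ?_
  · exact memLp_one_iff_integrable.1 (hW.smul (h.memLp_residual β))
  · simp_rw [real_inner_smul_right, inner_whitened, mul_comm (residual β _)]
    exact hβ.integral_dotProduct_mul_residual_eq_zero h _

theorem CovariateMoment.eLpNorm_inner_whitened_le (h : CovariateMoment P qx Kx)
    (u : EuclideanSpace ℝ (Fin d)) :
    eLpNorm (fun z => inner ℝ u (whitened P z)) (.ofReal qx) P ≤ .ofReal (Kx * ‖u‖) := by
  rcases eq_or_ne u 0 with rfl | hu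
  · simp
  have hunit : (‖u‖⁻¹ • u).ofLp ⬝ᵥ (‖u‖⁻¹ • u).ofLp = 1 := by
    have hnorm : ‖‖u‖⁻¹ • u‖ = 1 := norm_smul_inv_norm hu
    have hinner := real_inner_self_eq_norm_sq (‖u‖⁻¹ • u)
    rwa [hnorm, one_pow, EuclideanSpace.inner_eq_star_dotProduct, star_trivial] at hinner
  have hscale : (fun z => inner ℝ u (whitened P z)) =
      ‖u‖ • fun z => (‖u‖⁻¹ • u).ofLp ⬝ᵥ (invSqrtGram P *ᵥ z.1) := by
    ext z
    simp [whitened, EuclideanSpace.inner_eq_star_dotProduct, dotProduct_comm _ u.ofLp,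
      mul_inv_cancel_left₀ (norm_ne_zero_iff.2 hu)]
  rw [hscale, eLpNorm_const_smul, mul_comm Kx, ENNReal.ofReal_mul (norm_nonneg u), enorm_norm,
    ← ofReal_norm u]
  gcongr
  exact h _ hunit

theorem IsRegressionLaw.whitenedModel (h : IsRegressionLaw P) (hβ : IsProjectionParameter P β)
    (he : ErrorMoment P β q Ky) (hx : CovariateMoment P qx Kx) :
    WhitenedModel P (whitened P) (residual β) qx q Kx Ky where
  measurable_covariate := measurable_whitened
  measurable_error := measurable_residual
  integral_inner_sq := h.integral_inner_whitened_sq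
  integral_smul_eq_zero := hβ.integral_residual_smul_whitened_eq_zero h
  eLpNorm_inner_le := hx.eLpNorm_inner_whitened_le
  eLpNorm_error_le := he

theorem IsLeastSquares.sum_smul_whitened_eq_zero {n : ℕ} {z : Fin n → (Fin d → ℝ) × ℝ}
    {b : Fin d → ℝ} (hb : IsLeastSquares (fun j => (z j).1) (fun j => (z j).2) b)
    (h : IsRegressionLaw P) (β : Fin d → ℝ) :
    ∑ j, (residual β (z j) - inner ℝ (whitened P (z j))
      (WithLp.toLp 2 (CFC.sqrt (gram P) *ᵥ (b - β)))) • whitened P (z j) = 0 := by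
  have hcoeff : ∀ j, residual β (z j) - inner ℝ (whitened P (z j))
      (WithLp.toLp 2 (CFC.sqrt (gram P) *ᵥ (b - β))) = (z j).2 - b ⬝ᵥ (z j).1 := fun j => by
    rw [h.inner_whitened_toLp_sqrt_gram, residual, dotProduct_sub, dotProduct_comm b]
    ring
  simp_rw [hcoeff, whitened, ← WithLp.toLp_smul, ← WithLp.toLp_sum, ← Matrix.mulVec_smul,
    ← Matrix.mulVec_sum, hb.sum_smul_eq_zero, Matrix.mulVec_zero, WithLp.toLp_zero]

end Whitening

section UnionBound

variable {E F : Type*} [MeasurableSpace E] {P : Measure E} [IsProbabilityMeasure P] {N : ℕ} {δ : ℝ}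

theorem measure_exists_removeNth_le {B : Set (E × (Fin N → E))}
    (hB : (P.prod (Measure.pi fun _ : Fin N => P)) B ≤ .ofReal (δ / (N + 1))) :
    (Measure.pi fun _ : Fin (N + 1) => P) {z | ∃ i, (z i, i.removeNth z) ∈ B} ≤ .ofReal δ := by
  have hpre : ∀ i : Fin (N + 1), (Measure.pi fun _ : Fin (N + 1) => P)
      {z | (z i, i.removeNth z) ∈ B} = (P.prod (Measure.pi fun _ : Fin N => P)) B := fun i =>
    (measurePreserving_piFinSuccAbove (fun _ : Fin (N + 1) => P) i).measure_preimage_equiv B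
  have hN : (N + 1 : ENNReal) = .ofReal (N + 1) := by
    rw [ENNReal.ofReal_add (by positivity) zero_le_one, ENNReal.ofReal_natCast, ENNReal.ofReal_one]
  calc (Measure.pi fun _ : Fin (N + 1) => P) {z | ∃ i, (z i, i.removeNth z) ∈ B}
      ≤ ∑ i, (Measure.pi fun _ : Fin (N + 1) => P) {z | (z i, i.removeNth z) ∈ B} := by
        rw [Set.ofPred_exists]
        exact measure_iUnion_fintype_le _ _
    _ = (N + 1) * (P.prod (Measure.pi fun _ : Fin N => P)) B := by simp [hpre]
    _ ≤ .ofReal (N + 1) * .ofReal (δ / (N + 1)) := by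
        rw [hN]
        gcongr
    _ = .ofReal δ := by
        rw [← ENNReal.ofReal_mul (by positivity), mul_div_cancel₀ _ (by positivity)]

theorem measure_exists_apply_le {B : Set E} (hB : P B ≤ .ofReal (δ / (N + 1))) :
    (Measure.pi fun _ : Fin (N + 1) => P) {z | ∃ i, z i ∈ B} ≤ .ofReal δ := by
  simpa using measure_exists_removeNth_le (B := B ×ˢ Set.univ)
    (by rwa [Measure.prod_prod, measure_univ, mul_one])

theorem measure_exists_removeNth_mem_le {B : Set (Fin N → E)}
    (hB : (Measure.pi fun _ : Fin N => P) B ≤ .ofReal (δ / (N + 1))) :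
    (Measure.pi fun _ : Fin (N + 1) => P) {z | ∃ i : Fin (N + 1), i.removeNth z ∈ B} ≤
      .ofReal δ := by
  simpa using measure_exists_removeNth_le (B := Set.univ ×ˢ B)
    (by rwa [Measure.prod_prod, measure_univ, one_mul])

theorem measure_exists_lt_norm_le_of_eLpNorm_le [NormedAddCommGroup F] {Z : E → F} {p A : ℝ}
    (hp : 0 < p) (hA : 0 < A) (hδ : 0 < δ) (hZ : AEStronglyMeasurable Z P)
    (hZA : eLpNorm Z (.ofReal p) P ≤ .ofReal A) :
    (Measure.pi fun _ : Fin (N + 1) => P)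
      {z | ∃ i, A * ((N + 1) / δ) ^ (1 / p) < ‖Z (z i)‖} ≤ .ofReal δ := by
  refine measure_exists_apply_le (B := {x | _ < ‖Z x‖}) ?_
  convert measure_lt_norm_le_of_eLpNorm_le hp hA.le (T := A * ((N + 1) / δ) ^ (1 / p))
    (by positivity) hZ hZA using 2
  rw [← div_div, div_self hA.ne', one_div, Real.inv_rpow (by positivity),
    ← Real.rpow_mul (by positivity), one_div_mul_cancel hp.ne', Real.rpow_one, inv_div]

end UnionBound

section LeaveOneOut

variable {E : Type*} [MeasurableSpace E] {d N : ℕ} {P : Measure E} [IsProbabilityMeasure P]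
  {W : E → EuclideanSpace ℝ (Fin d)} {e : E → ℝ} {qx q Kx Ky c ℓ δ₀ δ₁ δ₂ : ℝ}

/-- The size of the `L^qx` norm of the sum of at most `n` scores `eⱼ Wⱼ`, each truncated at norm
`√d * Kx * Ky * ℓ ^ (1 / q_{1,1})`. -/
noncomputable def scoreSumScale (n d : ℕ) (qx q Kx Ky ℓ : ℝ) : ℝ :=
  rosenthalConst qx * truncSumScale n ℓ (harm qx q 1 1) qx (√d * Kx * Ky)

theorem scoreSumScale_pos (hqx : 4 ≤ qx) (hKx : 0 < Kx) (hKy : 0 < Ky) (hd : 0 < d) (hℓ : 0 < ℓ) :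
    0 < scoreSumScale (N + 1) d qx q Kx Ky ℓ := by
  have hK := one_le_rosenthalConst (p := qx) (by linarith)
  unfold scoreSumScale truncSumScale
  positivity

/-- The bound on the leave-one-out prediction errors, up to the factor `‖A⁻¹‖` for the Gram operator
`A` of the remaining observations. -/
noncomputable def predictionScale (n d : ℕ) (qx q Kx Ky δ₁ δ₂ : ℝ) : ℝ :=
  scoreSumScale n d qx q Kx Ky (2 * n / δ₁) * Kx * (2 * n / δ₁) ^ (1 / qx)
    + d * Kx ^ 2 * Ky * (n / δ₂) ^ (1 / harm qx q 2 1)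

theorem log_succ_div_nonneg (hδ₀ : 0 < δ₀) (hδ₀' : δ₀ ≤ 1) : 0 ≤ Real.log ((N + 1) / δ₀) :=
  Real.log_nonneg ((one_le_div hδ₀).2 (hδ₀'.trans (le_add_of_nonneg_left N.cast_nonneg)))

theorem pos_of_mul_add_log_le (hKx : 0 < Kx) (hd : 0 < d) (hδ₀ : 0 < δ₀) (hδ₀' : δ₀ ≤ 1)
    (hN : 80 * Kx ^ 4 * (d + 2 * Real.log ((N + 1) / δ₀)) ≤ N) : 0 < N := by
  have hlog := log_succ_div_nonneg (N := N) hδ₀ hδ₀'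
  exact Nat.cast_pos.1 (lt_of_lt_of_le (by positivity) hN)

namespace WhitenedModel

theorem lintegral_norm_sum_truncNorm_score_rpow_le (h : WhitenedModel P W e qx q Kx Ky)
    (hqx : 4 ≤ qx) (hq : 0 < q) (hs : 2 ≤ harm qx q 1 1) (hKx : 0 < Kx) (hKy : 0 < Ky)
    (hd : 0 < d) (hℓ : N + 1 ≤ ℓ) {a : ℝ} (ha : 0 ≤ a) :
    ∫⁻ z, .ofReal ((a * ‖∑ j, truncNorm (√d * Kx * Ky * ℓ ^ (1 / harm qx q 1 1))
        (e (z j) • W (z j))‖) ^ qx) ∂(Measure.pi fun _ : Fin N => P) ≤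
      .ofReal ((a * scoreSumScale (N + 1) d qx q Kx Ky ℓ) ^ qx) := by
  have hA : 0 < √d * Kx * Ky := by positivity
  have hℓ0 : 0 < ℓ := by linarith [Nat.cast_nonneg (α := ℝ) N]
  have hZ : AEStronglyMeasurable (fun x => e x • W x) P :=
    (h.measurable_error.smul h.measurable_covariate).aestronglyMeasurable
  have hsqx : harm qx q 1 1 ≤ qx := by
    rw [harm, inv_le_comm₀ (by positivity) (by positivity), ← one_div]
    exact le_add_of_nonneg_right (by positivity)
  have hmoment := integral_norm_sum_truncNorm_rpow_le (by linarith) hs hsqx hA hZ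
    (h.eLpNorm_score_le (by linarith) hq hKy.le) h.integral_smul_eq_zero (n := N + 1)
    (by positivity) hℓ (N := N) (by linarith)
  have hmem : MemLp (fun z : Fin N → E => ∑ j, truncNorm (√d * Kx * Ky * ℓ ^ (1 / harm qx q 1 1))
      (e (z j) • W (z j))) (.ofReal qx) (Measure.pi fun _ => P) :=
    memLp_finsetSum _ fun j _ => (memLp_truncNorm (by positivity) hZ _).comp_measurePreserving
      (measurePreserving_eval (fun _ => P) j)
  simp_rw [Real.mul_rpow ha (norm_nonneg _)]
  rw [← ofReal_integral_eq_lintegral_ofReal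
    ((integrable_norm_rpow_of_memLp (by linarith) hmem).const_mul _)
    (ae_of_all _ fun z => by positivity), integral_const_mul,
    Real.mul_rpow ha (scoreSumScale_pos hqx hKx hKy hd hℓ0).le]
  gcongr
  exact_mod_cast hmoment

theorem measure_prod_lt_abs_inner_normalSolution_le (h : WhitenedModel P W e qx q Kx Ky)
    (hqx : 4 ≤ qx) (hq : 0 < q) (hs : 2 ≤ harm qx q 1 1) (hKx : 0 < Kx) (hKy : 0 < Ky)
    (hd : 0 < d) (hℓ : N + 1 ≤ ℓ) (hc : 0 < c) :
    (P.prod (Measure.pi fun _ : Fin N => P)) {y |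
      (∀ v, c * ‖v‖ ^ 2 ≤ ∑ j, inner ℝ v (W (y.2 j)) ^ 2) ∧
      (∀ j, ‖e (y.2 j) • W (y.2 j)‖ ≤ √d * Kx * Ky * ℓ ^ (1 / harm qx q 1 1)) ∧
      c⁻¹ * (scoreSumScale (N + 1) d qx q Kx Ky ℓ * Kx * ℓ ^ (1 / qx)) <
        |inner ℝ (normalSolution (fun j => W (y.2 j)) fun j => e (y.2 j)) (W y.1)|} ≤
      .ofReal ℓ⁻¹ := by
  have hℓ0 : 0 < ℓ := by linarith [Nat.cast_nonneg (α := ℝ) N]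
  have hS := scoreSumScale_pos (N := N) (q := q) hqx hKx hKy hd hℓ0
  have hW := h.measurable_covariate
  have he := h.measurable_error
  have hZ : Measurable fun x => e x • W x := he.smul hW
  set S := scoreSumScale (N + 1) d qx q Kx Ky ℓ
  set M := √d * Kx * Ky * ℓ ^ (1 / harm qx q 1 1)
  set T := c⁻¹ * (S * Kx * ℓ ^ (1 / qx)) with hT
  have hbound := measure_prod_lt_abs_inner_le (P := P) (π := Measure.pi fun _ : Fin N => P) hW
    (θ := fun z => normalSolution (fun j => W (z j)) fun j => e (z j))
    (measurable_normalSolution (fun j => hW.comp (measurable_pi_apply j))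
      fun j => he.comp (measurable_pi_apply j))
    (h := fun z => c⁻¹ * ‖∑ j, truncNorm M (e (z j) • W (z j))‖)
    (.const_mul (.norm (Finset.measurable_sum _ fun j _ =>
      (measurable_truncNorm M).comp (hZ.comp (measurable_pi_apply j)))) _)
    (by linarith) hKx.le (T := T) (by positivity) h.eLpNorm_inner_le
  have hscale : ∀ r, Kx * (c⁻¹ * r) / T = Kx * c⁻¹ / T * r := fun r => by ring
  simp only [hscale] at hbound
  refine (measure_mono ?_).trans (hbound.trans
    ((h.lintegral_norm_sum_truncNorm_score_rpow_le hqx hq hs hKx hKy hd hℓ (by positivity)).trans_eq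
      ?_))
  · rintro y ⟨hgram, htrunc, hlarge⟩
    refine ⟨?_, hlarge⟩
    simpa only [truncNorm, htrunc, if_true] using norm_normalSolution_le hc hgram _
  · have hratio : Kx * c⁻¹ / T * S = (ℓ ^ (1 / qx))⁻¹ := by
      rw [hT]
      field_simp
    rw [hratio, Real.inv_rpow (by positivity), ← Real.rpow_mul hℓ0.le,
      one_div_mul_cancel (by linarith), Real.rpow_one]

theorem measure_exists_gram_removeNth_le (h : WhitenedModel P W e qx q Kx Ky) (hqx : 4 ≤ qx)
    (hKx : 0 < Kx) (hd : 0 < d) (hδ₀ : 0 < δ₀) (hδ₀' : δ₀ ≤ 1)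
    (hN : 80 * Kx ^ 4 * (d + 2 * Real.log ((N + 1) / δ₀)) ≤ N) :
    (Measure.pi fun _ : Fin (N + 1) => P) {z | ∃ i : Fin (N + 1),
      ¬∀ v : EuclideanSpace ℝ (Fin d), N / 5 * ‖v‖ ^ 2 ≤ ∑ j, inner ℝ v (W (i.removeNth z j)) ^ 2} ≤
      .ofReal δ₀ := by
  refine measure_exists_removeNth_mem_le (B := {y | ¬∀ v : EuclideanSpace ℝ (Fin d),
    N / 5 * ‖v‖ ^ 2 ≤ ∑ j, inner ℝ v (W (y j)) ^ 2}) ?_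
  have hlog := log_succ_div_nonneg (N := N) hδ₀ hδ₀'
  have htail := (h.isotropicFourthMoment hqx hKx.le).measure_sum_inner_sq_lt_le hd (by positivity)
    hlog hN
  rwa [Real.exp_neg, Real.exp_log (by positivity), inv_div] at htail

theorem measure_not_forall_abs_inner_le (h : WhitenedModel P W e qx q Kx Ky)
    (hqx : 4 ≤ qx) (hq : 0 < q) (hs : 2 ≤ harm qx q 1 1) (hKx : 0 < Kx) (hKy : 0 < Ky)
    (hd : 0 < d) (hδ₀ : 0 < δ₀) (hδ₀' : δ₀ ≤ 1) (hδ₁ : 0 < δ₁) (hδ₁' : δ₁ ≤ 1) (hδ₂ : 0 < δ₂)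
    (hN : 80 * Kx ^ 4 * (d + 2 * Real.log ((N + 1) / δ₀)) ≤ N) :
    (Measure.pi fun _ : Fin (N + 1) => P) {z | ¬∀ θ,
      ∑ j, (e (z j) - inner ℝ (W (z j)) θ) • W (z j) = 0 → ∀ i, |inner ℝ (W (z i)) θ| ≤
        (N / 5 : ℝ)⁻¹ * predictionScale (N + 1) d qx q Kx Ky δ₁ δ₂} ≤
      .ofReal (δ₀ + δ₁ + δ₂) := by
  have hN0 := pos_of_mul_add_log_le hKx hd hδ₀ hδ₀' hN
  have hc : (0 : ℝ) < N / 5 := by positivity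
  have hℓ : (2 * (N + 1) / δ₁ : ℝ) = (N + 1) / (δ₁ / 2) := by field_simp
  have hnℓ : (N + 1 : ℝ) ≤ 2 * (N + 1) / δ₁ := by
    rw [hℓ]
    exact le_div_self (by positivity) (by positivity) (by linarith)
  have hW := h.measurable_covariate
  have he := h.measurable_error
  have hgram := h.measure_exists_gram_removeNth_le hqx hKx hd hδ₀ hδ₀' hN
  have htrunc := measure_exists_lt_norm_le_of_eLpNorm_le (N := N) (by linarith)
    (by positivity) (half_pos hδ₁) (he.smul hW).aestronglyMeasurable
    (h.eLpNorm_score_le (by linarith) hq hKy.le)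
  have hprod := measure_exists_removeNth_le (δ := δ₁ / 2)
    ((h.measure_prod_lt_abs_inner_normalSolution_le hqx hq hs hKx hKy hd hnℓ hc).trans_eq (by
      rw [hℓ, inv_div]))
  have hlev := measure_exists_lt_norm_le_of_eLpNorm_le (N := N) (p := harm qx q 2 1)
    (by unfold harm; positivity) (by positivity) hδ₂
    ((hW.norm.pow_const 2).mul he).aestronglyMeasurable
    (h.eLpNorm_leverage_le (by linarith) hq hKx.le hKy.le)
  rw [← hℓ] at htrunc
  rw [ENNReal.ofReal_add (by positivity) hδ₂.le, ENNReal.ofReal_add hδ₀.le hδ₁.le,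
    ← add_halves δ₁, ENNReal.ofReal_add (half_pos hδ₁).le (half_pos hδ₁).le, ← add_assoc,
    add_halves]
  refine (measure_mono fun z hz => ?_).trans ((measure_union_le _ _).trans (add_le_add
    ((measure_union_le _ _).trans (add_le_add
      ((measure_union_le _ _).trans (add_le_add hgram htrunc)) hprod)) hlev))
  by_contra hgood
  simp only [Set.mem_union, Set.mem_ofPred_eq, not_or, not_exists, not_not, not_and, not_lt,
    Pi.smul_apply', Pi.mul_apply] at hgood
  obtain ⟨⟨⟨hgram, htrunc⟩, hprod⟩, hlev⟩ := hgood
  refine hz fun θ hθ i => (abs_inner_le_of_normal_equations hc hθ i (hgram i)).trans ?_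
  rw [predictionScale, mul_add, Nat.cast_add_one]
  gcongr
  · exact hprod i (hgram i) fun j => htrunc _
  · exact hlev i

end WhitenedModel

end LeaveOneOut

section RateTerms

variable {n δ a b c x y : ℝ}

theorem div_rpow_div_self (hn : 0 < n) (hδ : 0 < δ) :
    (n / δ) ^ c / n = 1 / (δ ^ c * n ^ (1 - c)) := by
  have : 0 < δ ^ c := by positivity
  rw [Real.div_rpow hn.le hδ.le, Real.rpow_sub hn, Real.rpow_one]
  field_simp

theorem two_mul_div_rpow_le (hn : 0 ≤ n) (hδ : 0 < δ) (hc : c ≤ 1) :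
    (2 * n / δ) ^ c ≤ 2 * (n / δ) ^ c := by
  rw [mul_div_assoc, Real.mul_rpow zero_le_two (by positivity)]
  gcongr
  exact Real.rpow_le_self_of_one_le one_le_two hc

theorem sqrt_mul_rpow_div_le_sqrt (hn : 0 < n) (hδ : 0 < δ) (hx : 0 ≤ x) (hy : 0 ≤ y)
    (ha : a ≤ 1) :
    √x * (√n * (2 * n / δ) ^ a / n) ≤ 2 * √((x + y) / (δ ^ (2 * a) * n ^ (1 - 2 * a))) := by
  have hsq : (√n * (n / δ) ^ a / n) ^ 2 = 1 / (δ ^ (2 * a) * n ^ (1 - 2 * a)) := by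
    rw [← div_rpow_div_self hn hδ, div_pow, mul_pow, Real.sq_sqrt hn.le, mul_comm 2 a,
      Real.rpow_mul (by positivity), Real.rpow_two]
    field_simp
  calc √x * (√n * (2 * n / δ) ^ a / n) ≤ √x * (√n * (2 * (n / δ) ^ a) / n) := by
        gcongr
        exact two_mul_div_rpow_le hn.le hδ ha
    _ = 2 * √(x / (δ ^ (2 * a) * n ^ (1 - 2 * a))) := by
        rw [← mul_one_div x, ← hsq, Real.sqrt_mul hx, Real.sqrt_sq (by positivity)]
        ring
    _ ≤ 2 * √((x + y) / (δ ^ (2 * a) * n ^ (1 - 2 * a))) := by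
        gcongr
        exact le_add_of_nonneg_right hy

theorem rpow_mul_two_mul_div_rpow_div_le (hn : 1 ≤ n) (hδ : 0 < δ) (hδ' : δ ≤ 1) (ha : 0 ≤ a)
    (hb : 0 ≤ b) (hab : a + b ≤ 1) :
    n ^ a * (2 * n / δ) ^ (a + b) / n ≤
      2 / (δ ^ (2 * a + b) * n ^ (1 - (3 * a + 2 * b))) := by
  have hn0 : 0 < n := by linarith
  calc n ^ a * (2 * n / δ) ^ (a + b) / n ≤ n ^ a * (2 * (n / δ) ^ (a + b)) / n := by
        gcongr
        exact two_mul_div_rpow_le hn0.le hδ hab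
    _ = 2 / (δ ^ (a + b) * n ^ (1 - (2 * a + b))) := by
        have : 0 < δ ^ (a + b) := by positivity
        rw [Real.div_rpow hn0.le hδ.le, Real.rpow_sub hn0, Real.rpow_one,
          show 2 * a + b = a + (a + b) by ring, Real.rpow_add hn0 a (a + b)]
        field_simp
    _ ≤ 2 / (δ ^ (2 * a + b) * n ^ (1 - (3 * a + 2 * b))) := by
        have hδle : δ ^ (2 * a + b) ≤ δ ^ (a + b) :=
          Real.rpow_le_rpow_of_exponent_ge hδ hδ' (by linarith)
        have hnle : n ^ (1 - (3 * a + 2 * b)) ≤ n ^ (1 - (2 * a + b)) :=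
          Real.rpow_le_rpow_of_exponent_le hn (by linarith)
        gcongr

end RateTerms

section Rate

variable {d n N : ℕ} {qx q Kx Ky δ₀ δ₁ δ₂ : ℝ}

theorem rate_nonneg (n d : ℕ) (qx q : ℝ) (hδ₁ : 0 < δ₁) (hδ₂ : 0 < δ₂) :
    0 ≤ rate n d qx q δ₁ δ₂ := by
  unfold rate
  positivity

theorem rate_le_gramFactor_inv_mul_rate (h : 0 < gramFactor n d Kx δ₀) (hδ₁ : 0 < δ₁)
    (hδ₂ : 0 < δ₂) :
    rate n d qx q δ₁ δ₂ ≤ (gramFactor n d Kx δ₀)⁻¹ * rate n d qx q δ₁ δ₂ := by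
  refine le_mul_of_one_le_left (rate_nonneg n d qx q hδ₁ hδ₂) ((one_le_inv₀ h).2 ?_)
  exact sub_le_self _ (by positivity)

theorem le_of_gramFactor_pos (hKx : 1 ≤ Kx) (hd : 0 < d) (hδ₀ : 0 < δ₀) (hδ₀' : δ₀ ≤ 1)
    (h : 0 < gramFactor (N + 1) d Kx δ₀) :
    80 * Kx ^ 4 * (d + 2 * Real.log ((N + 1) / δ₀)) ≤ N := by
  rw [gramFactor, Nat.cast_add_one] at h
  set n : ℝ := N + 1 with hn
  have : 1 ≤ n := by linarith [Nat.cast_nonneg (α := ℝ) N]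
  have hd1 : (1 : ℝ) ≤ d := by exact_mod_cast hd
  have hlog : Real.log (n / δ₀) ≤ Real.log (2 * n / δ₀) := by
    gcongr
    linarith
  have hlog0 := log_succ_div_nonneg (N := N) hδ₀ hδ₀'
  rw [← hn] at hlog0
  set x : ℝ := d + 2 * Real.log (2 * n / δ₀)
  have hsq : (9 * Kx ^ 2 * √(x / n)) ^ 2 ≤ 1 := pow_le_one₀ (by positivity) (by linarith)
  rw [mul_pow, Real.sq_sqrt (div_nonneg (by linarith) (by linarith)), ← mul_div_assoc,
    div_le_one (by linarith)] at hsq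
  have hKx4 : 1 ≤ Kx ^ 4 * x :=
    one_le_mul_of_one_le_of_one_le (one_le_pow₀ hKx) (by linarith)
  calc 80 * Kx ^ 4 * (d + 2 * Real.log (n / δ₀)) ≤ 80 * Kx ^ 4 * x := by
        gcongr
        linarith
    _ ≤ (N : ℝ) := by linarith

theorem scoreSumScale_mul_rpow_div_le (hqx : 4 ≤ qx) (hq : 0 < q) (hs : 2 ≤ harm qx q 1 1)
    (hKy : 0 < Ky) (hn : 0 < n) (hδ₁ : 0 < δ₁) (hδ₁' : δ₁ ≤ 1) :
    scoreSumScale n d qx q Kx Ky (2 * n / δ₁) * Kx * (2 * n / δ₁) ^ (1 / qx) / n ≤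
      2 * rosenthalConst qx * Kx ^ 2 * Ky *
        (√((d + Real.log (2 * n / δ₁)) / (δ₁ ^ (2 * (1 / qx)) * n ^ (1 - 2 * (1 / qx))))
          + √d / (δ₁ ^ (1 / harm qx q 2 1) * n ^ (1 - 1 / harm qx q 3 2))) := by
  have hK := one_le_rosenthalConst (p := qx) (by linarith)
  have hn1 : (1 : ℝ) ≤ n := by exact_mod_cast hn
  have hab : 1 / harm qx q 1 1 ≤ 1 / 2 := one_div_le_one_div_of_le two_pos hs
  have ha0 : 0 < 1 / qx := by positivity
  have hb0 : 0 < 1 / q := by positivity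
  rw [scoreSumScale, truncSumScale]
  simp only [one_div_harm, one_mul] at hab ⊢
  set a := 1 / qx
  set b := 1 / q
  set ℓ : ℝ := 2 * n / δ₁
  have hcancel : (n / ℓ) ^ a * ℓ ^ a = (n : ℝ) ^ a := by
    rw [← Real.mul_rpow (by positivity) (by positivity), div_mul_cancel₀ _ (by positivity)]
  have hfirst := sqrt_mul_rpow_div_le_sqrt (by linarith) hδ₁ d.cast_nonneg
    (Real.log_nonneg ((one_le_div hδ₁).2 (by linarith))) (show a ≤ 1 by linarith)
    (n := n) (y := Real.log ℓ)
  have hsecond := mul_le_mul_of_nonneg_left (rpow_mul_two_mul_div_rpow_div_le hn1 hδ₁ hδ₁' ha0.le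
    hb0.le (by linarith)) (Real.sqrt_nonneg d)
  calc rosenthalConst qx * (√d * Kx * Ky * (√n + (n / ℓ) ^ a * ℓ ^ (a + b))) * Kx * ℓ ^ a / n
      = rosenthalConst qx * Kx ^ 2 * Ky *
          (√d * (√n * ℓ ^ a / n) + √d * (n ^ a * ℓ ^ (a + b) / n)) := by
        rw [← hcancel]
        ring
    _ ≤ rosenthalConst qx * Kx ^ 2 * Ky * (2 * _ + √d * (2 / _)) := by gcongr
    _ = _ := by ring

theorem predictionScale_div_le (hqx : 4 ≤ qx) (hq : 0 < q) (hs : 2 ≤ harm qx q 1 1)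
    (hKy : 0 < Ky) (hn : 0 < n) (hδ₁ : 0 < δ₁) (hδ₁' : δ₁ ≤ 1) (hδ₂ : 0 < δ₂) :
    predictionScale n d qx q Kx Ky δ₁ δ₂ / n ≤
      2 * rosenthalConst qx * Kx ^ 2 * Ky * rate n d qx q δ₁ δ₂ := by
  have hK := one_le_rosenthalConst (p := qx) (by linarith)
  have hleverage : d * Kx ^ 2 * Ky * (n / δ₂) ^ (1 / harm qx q 2 1) / n ≤
      2 * rosenthalConst qx * Kx ^ 2 * Ky *
        (d / (δ₂ ^ (1 / harm qx q 2 1) * n ^ (1 - 1 / harm qx q 2 1))) := by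
    rw [mul_div_assoc, div_rpow_div_self (by positivity) hδ₂]
    calc _ = 1 * Kx ^ 2 * Ky *
          (d / (δ₂ ^ (1 / harm qx q 2 1) * n ^ (1 - 1 / harm qx q 2 1))) := by ring
      _ ≤ _ := by
        gcongr
        linarith
  rw [predictionScale, add_div, rate, mul_add, ← mul_one_div 2 qx]
  exact add_le_add (scoreSumScale_mul_rpow_div_le hqx hq hs hKy hn hδ₁ hδ₁') hleverage

theorem inv_mul_predictionScale_le (hqx : 4 ≤ qx) (hq : 0 < q) (hs : 2 ≤ harm qx q 1 1)
    (hKx : 0 ≤ Kx) (hKy : 0 < Ky) (hδ₁ : 0 < δ₁) (hδ₁' : δ₁ ≤ 1) (hδ₂ : 0 < δ₂) (hN : 0 < N) :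
    (N / 5 : ℝ)⁻¹ * predictionScale (N + 1) d qx q Kx Ky δ₁ δ₂ ≤
      20 * rosenthalConst qx * Kx ^ 2 * Ky * rate (N + 1) d qx q δ₁ δ₂ := by
  have hK := one_le_rosenthalConst (p := qx) (by linarith)
  have hN1 : (1 : ℝ) ≤ N := by exact_mod_cast hN
  have hscale : 0 ≤ predictionScale (N + 1) d qx q Kx Ky δ₁ δ₂ := by
    unfold predictionScale scoreSumScale truncSumScale
    positivity
  have hinv : (N / 5 : ℝ)⁻¹ ≤ 10 * (N + 1 : ℝ)⁻¹ := by
    rw [inv_div, ← div_eq_mul_inv, div_le_div_iff₀ (by positivity) (by positivity)]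
    linarith
  calc (N / 5 : ℝ)⁻¹ * predictionScale (N + 1) d qx q Kx Ky δ₁ δ₂
      ≤ 10 * (N + 1 : ℝ)⁻¹ * predictionScale (N + 1) d qx q Kx Ky δ₁ δ₂ := by gcongr
    _ = 10 * (predictionScale (N + 1) d qx q Kx Ky δ₁ δ₂ / (N + 1 : ℕ)) := by
        rw [Nat.cast_add_one, div_eq_inv_mul, mul_assoc]
    _ ≤ 10 * (2 * rosenthalConst qx * Kx ^ 2 * Ky * rate (N + 1) d qx q δ₁ δ₂) := by
        gcongr
        exact predictionScale_div_le hqx hq hs hKy N.succ_pos hδ₁ hδ₁' hδ₂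
    _ = 20 * rosenthalConst qx * Kx ^ 2 * Ky * rate (N + 1) d qx q δ₁ δ₂ := by ring

end Rate

section Transfer

theorem measure_mem_le_of_iIndepFun_of_hasLaw {Ω E ι : Type*} [MeasurableSpace Ω]
    [MeasurableSpace E] [Fintype ι] {μ : Measure Ω} {P : Measure E} {Z : ι → Ω → E}
    {B : Set (ι → E)} {ε : ENNReal} (hindep : iIndepFun Z μ) (hlaw : ∀ i, HasLaw (Z i) P μ)
    (hB : (Measure.pi fun _ : ι => P) B ≤ ε) : μ {ω | (fun i => Z i ω) ∈ B} ≤ ε := by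
  have := hindep.isProbabilityMeasure
  have hmap : μ.map (fun ω i => Z i ω) = Measure.pi fun _ : ι => P := by
    rw [iIndepFun.map_fun_eq_pi_map (fun i => (hlaw i).aemeasurable) hindep]
    simp_rw [fun i => (hlaw i).map_eq]
  exact (Measure.le_map_apply (aemeasurable_pi_lambda _ fun i => (hlaw i).aemeasurable) B).trans
    (hmap ▸ hB)

end Transfer

section Main

variable {d n : ℕ} {P : Measure ((Fin d → ℝ) × ℝ)} {β : Fin d → ℝ} {qx q Kx Ky δ₀ δ₁ δ₂ : ℝ}

theorem IsRegressionLaw.measure_pi_not_forall_abs_dotProduct_le (h : IsRegressionLaw P)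
    (hβ : IsProjectionParameter P β) (he : ErrorMoment P β q Ky) (hx : CovariateMoment P qx Kx)
    (hqx : 4 ≤ qx) (hq : 0 < q) (hs : 2 ≤ harm qx q 1 1) (hKx : 1 ≤ Kx) (hKy : 0 < Ky)
    (hδ₀ : 0 < δ₀) (hδ₁ : 0 < δ₁) (hδ₂ : 0 < δ₂) (hg : 0 < gramFactor n d Kx δ₀) :
    (Measure.pi fun _ : Fin n => P) {z | ¬∀ b,
      IsLeastSquares (fun i => (z i).1) (fun i => (z i).2) b → ∀ i, |(z i).1 ⬝ᵥ (b - β)| ≤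
        20 * rosenthalConst qx * Kx ^ 2 * Ky * rate n d qx q δ₁ δ₂} ≤
      .ofReal (δ₀ + δ₁ + δ₂) := by
  have := h.isProbabilityMeasure
  have hK := one_le_rosenthalConst (p := qx) (by linarith)
  have hrate := rate_nonneg n d qx q hδ₁ hδ₂
  obtain hsum | hsum := le_or_gt 1 (δ₀ + δ₁ + δ₂)
  · exact prob_le_one.trans (ENNReal.one_le_ofReal.2 hsum)
  obtain rfl | hd := d.eq_zero_or_pos
  · refine le_trans (measure_mono (t := ∅) fun z hz => ?_) (by simp)
    refine hz fun b _ i => ?_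
    rw [dotProduct, Fintype.sum_empty, abs_zero]
    positivity
  obtain _ | N := n
  · refine le_trans (measure_mono (t := ∅) fun z hz => ?_) (by simp)
    exact hz fun b _ i => i.elim0
  have hsize := le_of_gramFactor_pos hKx hd hδ₀ (by linarith) hg
  refine le_trans (measure_mono fun z hz => ?_)
    ((h.whitenedModel hβ he hx).measure_not_forall_abs_inner_le hqx hq hs (by linarith) hKy hd hδ₀
      (by linarith) hδ₁ (by linarith) hδ₂ hsize)
  refine fun hgood => hz fun b hb i => ?_
  rw [← h.inner_whitened_toLp_sqrt_gram]
  exact (hgood _ (hb.sum_smul_whitened_eq_zero h β) i).trans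
    (inv_mul_predictionScale_le hqx hq hs (by linarith) hKy hδ₁ (by linarith) hδ₂
      (pos_of_mul_add_log_le (by linarith) hd hδ₀ (by linarith) hsize))

end Main

end LinReg

theorem theoremA1_general (qx : ℝ) (hqx : 4 ≤ qx) :
    ∃ C : ℝ, 0 < C ∧
      ∀ (q Kx Ky : ℝ), 0 < q → 2 ≤ (1 / qx + 1 / q)⁻¹ → 1 ≤ Kx → 0 < Ky →
      ∀ (n d : ℕ) (P : Measure ((Fin d → ℝ) × ℝ)) (β : Fin d → ℝ),
        LinReg.IsRegressionLaw P →
        LinReg.IsProjectionParameter P β →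
        LinReg.ErrorMoment P β q Ky →
        LinReg.CovariateMoment P qx Kx →
        ∀ {Ω : Type*} [MeasurableSpace Ω] (μ : Measure Ω)
          (X : Fin n → Ω → Fin d → ℝ) (Y : Fin n → Ω → ℝ) (βhat : Ω → Fin d → ℝ),
          iIndepFun (fun i ω => (X i ω, Y i ω)) μ →
          (∀ i, HasLaw (fun ω => (X i ω, Y i ω)) P μ) →
          (∀ᵐ ω ∂μ, LinReg.IsLeastSquares (fun i => X i ω) (fun i => Y i ω) (βhat ω)) →
          ∀ δ₀ δ₁ δ₂ : ℝ, 0 < δ₀ → 0 < δ₁ → 0 < δ₂ →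
            0 < LinReg.gramFactor n d Kx δ₀ →
            μ {ω | ¬ ∀ i, |X i ω ⬝ᵥ (βhat ω - β)| ≤
                C * Kx ^ 2 * Ky * LinReg.rate n d qx q δ₁ δ₂} ≤
              ENNReal.ofReal (δ₀ + δ₁ + δ₂) := by
  have hK := LinReg.one_le_rosenthalConst (p := qx) (by linarith)
  refine ⟨20 * LinReg.rosenthalConst qx, by positivity, ?_⟩
  intro q Kx Ky hq hs hKx hKy n d P β hP hβ he hx Ω _ μ X Y βhat hindep hlaw hls δ₀ δ₁ δ₂
    hδ₀ hδ₁ hδ₂ hg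
  refine (measure_mono_ae ?_).trans (LinReg.measure_mem_le_of_iIndepFun_of_hasLaw hindep hlaw
    (hP.measure_pi_not_forall_abs_dotProduct_le hβ he hx hqx hq hs hKx hKy hδ₀ hδ₁ hδ₂ hg))
  filter_upwards [hls] with ω hω hbad hgood
  exact hbad (hgood _ hω)

/-- When the positive part of `gramFactor` vanishes, its inverse is `+∞` and the bound is void;
hence the hypothesis `0 < gramFactor n d Kx δ₀`. "With probability at least `1 - δ₀ - δ₁ - δ₂`" is
stated through the (outer) measure of the complementary event. The estimate `βhat` is any
minimizer of the empirical squared loss. -/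
theorem theoremA1 (qx q Kx Ky lo : ℝ) (hqx : 4 ≤ qx) (hq : 2 ≤ q)
    (hs : 2 < (1 / qx + 1 / q)⁻¹) (hKx : 1 ≤ Kx) (hKy : 0 < Ky) (hlo : 0 < lo) :
    ∃ C : ℝ, 0 < C ∧
      ∀ (n d : ℕ) (P : Measure ((Fin d → ℝ) × ℝ)) (β : Fin d → ℝ) (hi : ℝ),
        LinReg.IsRegressionLaw P →
        LinReg.IsProjectionParameter P β →
        LinReg.ErrorMoment P β q Ky →
        LinReg.CovariateMoment P qx Kx →
        lo ≤ hi → LinReg.ScoreEigenvalueBounds P β lo hi →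
        ∀ {Ω : Type*} [MeasurableSpace Ω] (μ : Measure Ω) [IsProbabilityMeasure μ]
          (X : Fin n → Ω → Fin d → ℝ) (Y : Fin n → Ω → ℝ) (βhat : Ω → Fin d → ℝ),
          iIndepFun (fun i ω => (X i ω, Y i ω)) μ →
          (∀ i, HasLaw (fun ω => (X i ω, Y i ω)) P μ) →
          (∀ᵐ ω ∂μ, LinReg.IsLeastSquares (fun i => X i ω) (fun i => Y i ω) (βhat ω)) →
          ∀ δ₀ δ₁ δ₂ : ℝ, 0 < δ₀ → 0 < δ₁ → 0 < δ₂ →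
            0 < LinReg.gramFactor n d Kx δ₀ →
            μ {ω | ¬ ∀ i, |X i ω ⬝ᵥ (βhat ω - β)| ≤
                C * (LinReg.gramFactor n d Kx δ₀)⁻¹ * LinReg.rate n d qx q δ₁ δ₂} ≤
              ENNReal.ofReal (δ₀ + δ₁ + δ₂) := by
  obtain ⟨C, hC, hbound⟩ := theoremA1_general qx hqx
  refine ⟨C * Kx ^ 2 * Ky, by positivity, ?_⟩
  intro n d P β hi hP hβ he hx _ _ Ω _ μ _ X Y βhat hindep hlaw hls δ₀ δ₁ δ₂ hδ₀ hδ₁ hδ₂ hg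
  refine le_trans (measure_mono fun ω hω => ?_)
    (hbound q Kx Ky (by linarith) hs.le hKx hKy n d P β hP hβ he hx μ X Y βhat hindep hlaw hls
      δ₀ δ₁ δ₂ hδ₀ hδ₁ hδ₂ hg)
  refine fun h => hω fun i => (h i).trans ?_
  rw [mul_assoc _ (_)⁻¹]
  gcongr
  exact LinReg.rate_le_gramFactor_inv_mul_rate hg hδ₁ hδ₂
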